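/- Fix a countable set $AP$ of atomic propositions (effectively coded). Let $P^-$ be a finite set of system processes and let $\mathcal A$ be an architecture: finite sets $O_{env}\subseteq AP$ of environment outputs and, for each $p\in P^-$, $I_p, O_p\subseteq AP$ of inputs and outputs of $p$, where $O_{env}$ and the sets $O_p$ are pairwise disjoint. The asynchronous architecture $\mathcal A^*$ adds a fresh scheduling proposition $\mathit{sched}_p$ for each $p\in P^-$, with $O^*_{env}=O_{env}\cup\{\mathit{sched}_p\mid p\in P^-\}$, $I_p^*=I_p\cup\{\mathit{sched}_p\}$ and $O_p^*=O_p$. PROMPT-LTL formulas are given by $\varphi ::= a\mid\neg a\mid\varphi\wedge\varphi\mid\varphi\vee\varphi\mid \mathbf X\varphi\mid\varphi\,\mathbf U\,\varphi\mid\varphi\,\mathbf R\,\varphi\mid\mathbf F_{\mathbf P}\varphi$, where $a$ is a proposition. For an infinite word $w$ of sets of propositions and a bound $k\in\mathbb N$, $(w,n,k)\models\varphi$ is the usual LTL semantics at position $n$, with $(w,n,k)\models\mathbf F_{\mathbf P}\varphi$ iff $(w,n+j,k)\models\varphi$ for some $0\le j\le k$; and $(w,k)\models\varphi$ means $(w,0,k)\models\varphi$.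 A strategy for $p$ is a function $f_p:(2^{I^*_p})^*\to 2^{O^*_p}$. It is an (asynchronous) finite-state strategy if there are a finite set $S$, an initial state $s_0\in S$, a transition function $\Delta:S\times 2^{I_p^*}\to S$ and a labeling $l:S\to 2^{O_p^*}$ such that $f_p(u)=l(\Delta^*(u))$ for all $u$, where $\Delta^*(u)$ is the state reached from $s_0$ by reading $u$, and such that the state does not change when $p$ is not scheduled: $\Delta^*(u\cdot a)=\Delta^*(u)$ for all $u\in(2^{I_p^*})^*$ and all $a\in 2^{I_p^*}$ with $\mathit{sched}_p\notin a$. The distributed product $\bigotimes_{p\in P^-} f_p$ is the set of words $w=w_0w_1w_2\cdots$ for which there is an environment sequence $e_0e_1e_2\cdots\in(2^{O^*_{env}})^\omega$ with $$w_n=e_n\cup\bigcup_{p\in P^-} f_p\big((w_0\cap I_p^*)\cdots(w_{n-1}\cap I_p^*)\big)\quad\text{for all } n\in\mathbb N.$$ An assume-guarantee specification is a pair $\langle\varphi,\psi\rangle$ of PROMPT-LTL formulas over $AP\cup\{\mathit{sched}_p\mid p\in P^-\}$. It is realizable in $\mathcal A^*$ if there are asynchronous finite-state strategies $f_p$, one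 for each $p\in P^-$, such that for every $k\in\mathbb N$ there is an $l\in\mathbb N$ such that for every $w\in\bigotimes_{p\in P^-}f_p$: $(w,k)\models\varphi$ implies $(w,l)\models\psi$. **Corollary.** For every asynchronous architecture $\mathcal A^*$, the PROMPT-LTL assume-guarantee realizability problem for $\mathcal A^*$ is semi-decidable: the set of all pairs $\langle\varphi,\psi\rangle$ (written as strings of symbols) that are realizable in $\mathcal A^*$ is recursively enumerable. -/

import Mathlib

/-- PROMPT-LTL formulas in negation normal form over atomic propositions from `σ`:
literals, conjunction, disjunction, next, until, release, and the prompt-eventually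
operator `F_P`. -/
inductive PromptLTL (σ : Type*) where
  | lit (positive : Bool) (a : σ) : PromptLTL σ
  | and (φ ψ : PromptLTL σ) : PromptLTL σ
  | or (φ ψ : PromptLTL σ) : PromptLTL σ
  | next (φ : PromptLTL σ) : PromptLTL σ
  | untl (φ ψ : PromptLTL σ) : PromptLTL σ
  | release (φ ψ : PromptLTL σ) : PromptLTL σ
  | prompt (φ : PromptLTL σ) : PromptLTL σ

namespace PromptLTL

/-- `φ.Sat w k n` is the satisfaction relation `(w, n, k) ⊨ φ`: the formula `φ` holds at
position `n` of the infinite word `w` with respect to the bound `k`. -/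
def Sat {σ : Type*} (w : ℕ → Set σ) (k : ℕ) : PromptLTL σ → ℕ → Prop
  | lit true a, n => a ∈ w n
  | lit false a, n => a ∉ w n
  | and φ ψ, n => φ.Sat w k n ∧ ψ.Sat w k n
  | or φ ψ, n => φ.Sat w k n ∨ ψ.Sat w k n
  | next φ, n => φ.Sat w k (n + 1)
  | untl φ ψ, n => ∃ j, ψ.Sat w k (n + j) ∧ ∀ i < j, φ.Sat w k (n + i)
  | release φ ψ, n => ∀ j, ψ.Sat w k (n + j) ∨ ∃ i < j, φ.Sat w k (n + i)
  | prompt φ, n => ∃ j ≤ k, φ.Sat w k (n + j)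

/-- `(w, k) ⊨ φ`. -/
def Models {σ : Type*} (w : ℕ → Set σ) (k : ℕ) (φ : PromptLTL σ) : Prop := φ.Sat w k 0

/-- The symbols of the textual form of a formula: literals and the six operators. -/
abbrev Symb (σ : Type*) := (Bool × σ) ⊕ Fin 6

/-- The textual form of a formula, in Polish (prefix) notation. -/
def text {σ : Type*} : PromptLTL σ → List (Symb σ)
  | lit b a => [Sum.inl (b, a)]
  | and φ ψ => Sum.inr 0 :: (φ.text ++ ψ.text)
  | or φ ψ => Sum.inr 1 :: (φ.text ++ ψ.text)
  | next φ => Sum.inr 2 :: φ.text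
  | untl φ ψ => Sum.inr 3 :: (φ.text ++ ψ.text)
  | release φ ψ => Sum.inr 4 :: (φ.text ++ ψ.text)
  | prompt φ => Sum.inr 5 :: φ.text

theorem text_append_inj {σ : Type*} (φ : PromptLTL σ) :
    ∀ (ψ : PromptLTL σ) (r s : List (Symb σ)),
      φ.text ++ r = ψ.text ++ s → φ = ψ ∧ r = s := by
  induction φ with
  | lit b a => intro ψ r s h; cases ψ <;> simp_all [text]
  | next φ ih =>
    intro ψ r s h
    cases ψ <;> simp [text] at h
    obtain ⟨rfl, rfl⟩ := ih _ _ _ h; exact ⟨rfl, rfl⟩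
  | prompt φ ih =>
    intro ψ r s h
    cases ψ <;> simp [text] at h
    obtain ⟨rfl, rfl⟩ := ih _ _ _ h; exact ⟨rfl, rfl⟩
  | and φ₁ φ₂ ih₁ ih₂ | or φ₁ φ₂ ih₁ ih₂ | untl φ₁ φ₂ ih₁ ih₂ | release φ₁ φ₂ ih₁ ih₂ =>
    intro ψ r s h
    cases ψ <;> simp [text] at h
    obtain ⟨rfl, h₂⟩ := ih₁ _ _ _ h
    obtain ⟨rfl, rfl⟩ := ih₂ _ _ _ h₂; exact ⟨rfl, rfl⟩

/-- A formula is determined by its textual form. -/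
theorem text_injective {σ : Type*} : Function.Injective (text (σ := σ)) := fun φ ψ h =>
  (text_append_inj φ ψ [] [] (by simpa using h)).1

end PromptLTL

/-- A strategy `f : (2^I)* → 2^O`, where `I` and `O` are sets of propositions from `σ`. -/
abbrev Strategy {σ : Type*} (I O : Set σ) := List (Set I) → Set O

/-- The run of `f` on the infinite input sequence `e`: the infinite word
`(f(ε) ∪ e₀) (f(e₀) ∪ e₁) (f(e₀e₁) ∪ e₂) ⋯`. -/
def Strategy.run {σ : Type*} {I O : Set σ} (f : Strategy I O) (e : ℕ → Set I) :
    ℕ → Set σ :=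
  fun n => Subtype.val '' f ((List.range n).map e) ∪ Subtype.val '' e n

/-- The set of infinite words produced by `f`. -/
def Strategy.words {σ : Type*} {I O : Set σ} (f : Strategy I O) : Set (ℕ → Set σ) :=
  Set.range f.run

/-- A `2^O`-labeled `2^I`-transition system with set of states `S`. -/
structure TransitionSystem {σ : Type*} (I O : Set σ) (S : Type*) where
  init : S
  step : S → Set I → S
  label : S → Set O

namespace TransitionSystem

variable {σ : Type*} {I O : Set σ} {S : Type*}

/-- The state `Δ*(u)` reached from the initial state by reading `u`. -/
def reach (T : TransitionSystem I O S) (u : List (Set I)) : S := u.foldl T.step T.init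

/-- `T` generates the strategy `f`. -/
def Generates (T : TransitionSystem I O S) (f : Strategy I O) : Prop :=
  ∀ u, f u = T.label (T.reach u)

end TransitionSystem

/-- An architecture with finite set `P` of system processes (the environment process is not
an element of `P`), over the atomic propositions `AP`. The environment has no inputs and
the outputs `envOutputs`. Different processes may share inputs, but the outputs of the
processes, including the environment, are pairwise disjoint. -/
structure Architecture (P AP : Type*) where
  envOutputs : Finset AP
  inputs : P → Finset AP
  outputs : P → Finset AP
  disjoint_env : ∀ p, Disjoint envOutputs (outputs p)
  disjoint_outputs : ∀ p q, p ≠ q → Disjoint (outputs p) (outputs q)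

/-- The propositions of the asynchronous version of an architecture: the original ones and
a proposition `sched p` for every system process `p`. -/
abbrev Signal (P AP : Type*) := AP ⊕ P

/-- The scheduling proposition of process `p`. -/
abbrev Signal.sched {P AP : Type*} (p : P) : Signal P AP := Sum.inr p

namespace Architecture

variable {P AP : Type*} (A : Architecture P AP)

/-- `O*_env = O_env ∪ Sched`. -/
def asyncEnvOutputs : Set (Signal P AP) :=
  Sum.inl '' (A.envOutputs : Set AP) ∪ Set.range Signal.sched

/-- `I*_p = I_p ∪ {sched p}`. -/
def asyncInputs (p : P) : Set (Signal P AP) :=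
  Sum.inl '' (A.inputs p : Set AP) ∪ {Signal.sched p}

/-- `O*_p = O_p`. -/
def asyncOutputs (p : P) : Set (Signal P AP) := Sum.inl '' (A.outputs p : Set AP)

/-- The outputs of all system processes. -/
def allOutputs : Set (Signal P AP) := ⋃ p, A.asyncOutputs p

/-- `f` is a finite-state strategy for process `p` that respects the scheduling: it is
generated by a finite transition system whose state does not change when it reads an input
in which `p` is not scheduled. -/
def IsAsyncFiniteState (p : P) (f : Strategy (A.asyncInputs p) (A.asyncOutputs p)) : Prop :=
  ∃ (n : ℕ) (T : TransitionSystem (A.asyncInputs p) (A.asyncOutputs p) (Fin n)),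
    T.Generates f ∧
      ∀ (u : List (Set (A.asyncInputs p))) (a : Set (A.asyncInputs p)),
        Signal.sched p ∉ Subtype.val '' a → T.reach (u ++ [a]) = T.reach u

section Product

variable (f : ∀ p, Strategy (A.asyncInputs p) (A.asyncOutputs p))

/-- The joint output of the system processes when process `p` has seen the inputs `h p`. -/
def jointOutput (h : ∀ p, List (Set (A.asyncInputs p))) : Set (Signal P AP) :=
  ⋃ p, Subtype.val '' f p (h p)

/-- The sequence of inputs that each system process has seen after the environment has
produced the finite sequence `u`: in every step, process `p` sees the restriction to
`I*_p` of the current outputs of the environment and of all system processes. -/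
def localInputs (u : List (Set A.asyncEnvOutputs)) : ∀ p, List (Set (A.asyncInputs p)) :=
  u.foldl
    (fun h a p => h p ++ [Subtype.val ⁻¹' (A.jointOutput f h ∪ Subtype.val '' a)])
    (fun _ => [])

/-- The distributed product `⨂ p, f p`, a strategy with inputs `O*_env` and outputs
`⋃ p, O*_p`. -/
def product : Strategy A.asyncEnvOutputs A.allOutputs :=
  fun u => Subtype.val ⁻¹' A.jointOutput f (A.localInputs f u)

end Product

/-- The assume-guarantee specification `⟨φ, ψ⟩` is realizable in the asynchronous version
of `A` by finite-state strategies. -/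
def AsyncRealizable (φ ψ : PromptLTL (Signal P AP)) : Prop :=
  ∃ f : ∀ p, Strategy (A.asyncInputs p) (A.asyncOutputs p),
    (∀ p, A.IsAsyncFiniteState p (f p)) ∧
      ∀ k : ℕ, ∃ l : ℕ, ∀ w ∈ (A.product f).words, φ.Models w k → ψ.Models w l

end Architecture

/-! A family of finite-state strategies is a finite object. So it suffices that every realizing
family has a finite, checkable proof that it realizes `⟨φ, ψ⟩`: the realizable pairs are then found
by searching through families and proofs.

A family fails iff for some `k` there is, for every `l`, a word with `(w, k) ⊨ φ` and `(w, l) ⊭ ψ`.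
This is turned into a property of a finite graph. A node holds a global state, an environment letter
and claims about subformulas, positive ones with respect to `k` and negative ones with respect to
`l`. The numbers are replaced by marks on edges. A negated prompt claim may be dropped only at the
second mark from then on, so it lasts long enough if marks are more than `l` steps apart. A mark is
allowed only at a node on a cycle of unmarked edges that serves every positive prompt claim: running
around that cycle moves marks apart without raising `k`. Failure then means that a cycle of allowed
edges that meets all eventualities is reachable from an initial node claiming `φ` and the negation
of `ψ`.

From cycles to words: `exists_long_blocks` gives one `k` and, for every `l`, a path with marks more
than `l` apart; `holds_of_tableau` shows that its claims are true. From words to cycles: in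
`exists_covers_markedStep` a single violating word for `k` and a large `l` is marked as early as
possible; by pigeonhole the marks come so quickly that no remembered claim outlives its `l` steps.
So without such a cycle an explicit `l` works for each `k`.

A certificate (`Certifies`) consists of tables for the strategies, global states, claims, and two
closed relations that contain the edges and in which no bad cycle shows up.
`realizable_iff_exists_certificate` is the equivalence; `primrecPred_certifies` makes the check
primitive recursive and `rePred_exists` performs the search. -/

set_option linter.unusedSectionVars false

open Relation

/-! ### Cycles in directed graphs that visit prescribed sets -/

namespace CycleCover

variable {V κ : Type*} {r : V → V → Prop} {H : κ → V → Prop} {Cl : List κ}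

/-- `x` lies on an `r`-cycle, and for every index `c` on one that meets `H c`. -/
def Covers (r : V → V → Prop) (H : κ → V → Prop) (Cl : List κ) (x : V) : Prop :=
  TransGen r x x ∧ ∀ c ∈ Cl, ∃ y, H c y ∧ TransGen r x y ∧ TransGen r y x

/-- The first `n` steps of `p` form an `r`-walk from `x` to `y`. -/
def IsWalk (r : V → V → Prop) (n : ℕ) (p : ℕ → V) (x y : V) : Prop :=
  p 0 = x ∧ p n = y ∧ ∀ i < n, r (p i) (p (i + 1))

theorem IsWalk.append {n m : ℕ} {p q : ℕ → V} {x y z : V} (h₁ : IsWalk r n p x y)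
    (h₂ : IsWalk r m q y z) :
    IsWalk r (n + m) (fun i => if i < n then p i else q (i - n)) x z := by
  obtain ⟨p0, pn, hp⟩ := h₁
  obtain ⟨q0, qm, hq⟩ := h₂
  refine ⟨?_, by simp [qm], fun i hi => ?_⟩
  · rcases Nat.eq_zero_or_pos n with rfl | hn
    · simp [q0, ← pn, p0]
    · simp [hn, p0]
  · rcases lt_trichotomy (i + 1) n with h | h | h
    · simpa [h, (Nat.lt_succ_self i).trans h] using hp i (by omega)
    · subst h
      simpa [q0, ← pn] using hp i (by omega)
    · have h1 : ¬ i < n := by omega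
      have h2 : ¬ i + 1 < n := by omega
      have h3 : i + 1 - n = i - n + 1 := by omega
      simpa [h1, h2, h3] using hq (i - n) (by omega)

theorem exists_isWalk {x y : V} (h : TransGen r x y) : ∃ n p, 0 < n ∧ IsWalk r n p x y := by
  induction h with
  | @single y h =>
    refine ⟨1, fun i => if i = 0 then x else y, one_pos, by simp, by simp, fun i hi => ?_⟩
    obtain rfl : i = 0 := by omega
    simpa using h
  | @tail y z _ h ih =>
    obtain ⟨n, p, hn, hp⟩ := ih
    refine ⟨n + 1, _, by omega, hp.append (m := 1) (q := fun i => if i = 0 then y else z)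
      ⟨by simp, by simp, fun i hi => ?_⟩⟩
    obtain rfl : i = 0 := by omega
    simpa using h

theorem Covers.exists_closed_walk {x : V} (h : Covers r H Cl x) :
    ∃ n p, 0 < n ∧ IsWalk r n p x x ∧ ∀ c ∈ Cl, ∃ j < n, H c (p j) := by
  obtain ⟨hx, h⟩ := h
  induction Cl with
  | nil =>
    obtain ⟨n, p, hn, hp⟩ := exists_isWalk hx
    exact ⟨n, p, hn, hp, by simp⟩
  | cons c Cl ih =>
    obtain ⟨n, p, hn, hp, hH⟩ := ih fun d hd => h d (by simp [hd])
    obtain ⟨y, hy, hxy, hyx⟩ := h c (by simp)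
    obtain ⟨m₁, q₁, hm₁, hq₁⟩ := exists_isWalk hxy
    obtain ⟨m₂, q₂, hm₂, hq₂⟩ := exists_isWalk hyx
    refine ⟨n + (m₁ + m₂), _, by omega, hp.append (hq₁.append hq₂), fun d hd => ?_⟩
    rcases List.mem_cons.1 hd with rfl | hd
    · exact ⟨n + m₁, by omega, by simpa [hq₂.1] using hy⟩
    · obtain ⟨j, hj, hj'⟩ := hH d hd
      exact ⟨j, by omega, by simpa [hj] using hj'⟩

theorem Covers.exists_periodic {x : V} (h : Covers r H Cl x) :
    ∃ (n : ℕ) (p : ℕ → V), 0 < n ∧ p 0 = x ∧ (∀ i, p (i + n) = p i) ∧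
      (∀ i, r (p i) (p (i + 1))) ∧ ∀ c ∈ Cl, ∀ i, ∃ j < n, H c (p (i + j)) := by
  obtain ⟨n, p, hn, ⟨p0, pn, hp⟩, hH⟩ := h.exists_closed_walk
  refine ⟨n, fun i => p (i % n), hn, by simpa using p0, by simp, fun i => ?_, fun c hc i => ?_⟩
  · have hi := Nat.mod_lt i hn
    have := hp _ hi
    beta_reduce
    rw [← Nat.mod_add_mod]
    rcases (Nat.succ_le_of_lt hi).lt_or_eq with h | h
    · rwa [Nat.mod_eq_of_lt h]
    · rw [Nat.succ_eq_add_one] at h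
      rw [h, pn] at this
      rwa [h, Nat.mod_self, p0]
  · obtain ⟨j, hj, hj'⟩ := hH c hc
    have hi := Nat.mod_lt i hn
    -- The distance from `i` forward to the next position congruent to `j` modulo `n`.
    refine ⟨(j + (n - i % n)) % n, Nat.mod_lt _ hn, ?_⟩
    have : (i + (j + (n - i % n)) % n) % n = j := by
      rw [Nat.add_mod, Nat.mod_mod, ← Nat.add_mod]
      have h1 : i + (j + (n - i % n)) = j + (n * (i / n + 1)) := by
        have := Nat.div_add_mod i n
        rw [Nat.mul_add]
        omega
      rw [h1, Nat.add_mul_mod_self_left, Nat.mod_eq_of_lt hj]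
    simpa [this] using hj'

/-- An infinite path into a covering cycle and around it, with bounded gaps between visits. -/
theorem Covers.exists_path {x₀ x : V} (h₀ : ReflTransGen r x₀ x) (h : Covers r H Cl x) :
    ∃ (K : ℕ) (p : ℕ → V), (Set.range p).Finite ∧ p 0 = x₀ ∧ (∀ i, r (p i) (p (i + 1))) ∧
      ∀ c ∈ Cl, ∀ i, ∃ j ≤ K, H c (p (i + j)) := by
  induction h₀ using ReflTransGen.head_induction_on with
  | refl =>
    obtain ⟨n, p, hn, p0, hper, hr, hH⟩ := h.exists_periodic
    refine ⟨n, p, ((Set.finite_Iio n).image p).subset ?_, p0, hr, fun c hc i => ?_⟩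
    · rintro _ ⟨i, rfl⟩
      refine ⟨i % n, Nat.mod_lt _ hn, ?_⟩
      exact (Function.Periodic.map_mod_nat (f := p) (a := n) hper i)
    · obtain ⟨j, hj, hj'⟩ := hH c hc i
      exact ⟨j, hj.le, hj'⟩
  | @head y z hyz _ ih =>
    obtain ⟨K, p, hfin, p0, hr, hH⟩ := ih
    -- Only the visits seen from the new first vertex are delayed, by one step.
    refine ⟨K + 1, fun i => i.casesOn y p, (hfin.insert y).subset ?_, rfl, fun i => ?_,
      fun c hc i => ?_⟩
    · rintro _ ⟨_ | i, rfl⟩ <;> simp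
    · cases i with
      | zero => simpa [p0] using hyz
      | succ i => exact hr i
    · cases i with
      | zero =>
        obtain ⟨j, hj, hj'⟩ := hH c hc 0
        exact ⟨j + 1, by omega, by simpa using hj'⟩
      | succ i =>
        obtain ⟨j, hj, hj'⟩ := hH c hc i
        refine ⟨j, by omega, ?_⟩
        have : i + 1 + j = (i + j) + 1 := by omega
        simpa [this] using hj'

/-! ### Pumping: inserting cycles into a path -/

section Insert

variable (T : ℕ → ℕ)

/-- The positions of the sequence that repeats the index `i` exactly `T i + 1` times. -/
def pos : ℕ → ℕ × ℕ
  | 0 => (0, 0)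
  | n + 1 => if (pos n).2 < T (pos n).1 then ((pos n).1, (pos n).2 + 1) else ((pos n).1 + 1, 0)

variable {T}

theorem pos_succ_of_lt {n : ℕ} (h : (pos T n).2 < T (pos T n).1) :
    pos T (n + 1) = ((pos T n).1, (pos T n).2 + 1) := by rw [pos, if_pos h]

theorem pos_succ_of_not_lt {n : ℕ} (h : ¬ (pos T n).2 < T (pos T n).1) :
    pos T (n + 1) = ((pos T n).1 + 1, 0) := by rw [pos, if_neg h]

theorem pos_snd_le (n : ℕ) : (pos T n).2 ≤ T (pos T n).1 := by
  induction n with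
  | zero => simp [pos]
  | succ n ih =>
    by_cases h : (pos T n).2 < T (pos T n).1
    · rw [pos_succ_of_lt h]; exact h
    · rw [pos_succ_of_not_lt h]; simp

theorem pos_add {n i s : ℕ} (hn : pos T n = (i, s)) (j : ℕ) (hj : s + j ≤ T i) :
    pos T (n + j) = (i, s + j) := by
  induction j with
  | zero => simpa using hn
  | succ j ih =>
    have := ih (by omega)
    rw [← Nat.add_assoc, pos_succ_of_lt (by rw [this]; simp; omega), this]
    simp [Nat.add_assoc]

theorem pos_next {n i s : ℕ} (hn : pos T n = (i, s)) :
    pos T (n + (T i - s) + 1) = (i + 1, 0) := by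
  have hs : s ≤ T i := by simpa [hn] using pos_snd_le (T := T) n
  have := pos_add hn (T i - s) (by omega)
  rw [pos_succ_of_not_lt (by rw [this]; simp; omega), this]

theorem pos_later {n i s : ℕ} (hn : pos T n = (i, s)) (d : ℕ) :
    ∃ m, pos T (n + m) = (i + 1 + d, 0) := by
  induction d with
  | zero => exact ⟨_, by simpa [Nat.add_assoc] using pos_next hn⟩
  | succ d ih =>
    obtain ⟨m, hm⟩ := ih
    exact ⟨_, by simpa [Nat.add_assoc] using pos_next hm⟩

theorem pos_snd_le_sub {n i : ℕ} (hn : pos T n = (i, 0)) (j : ℕ) : (pos T (n + j)).2 ≤ j := by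
  induction j with
  | zero => simp [hn]
  | succ j ih =>
    rw [← Nat.add_assoc]
    by_cases h : (pos T (n + j)).2 < T (pos T (n + j)).1
    · rw [pos_succ_of_lt h]; exact Nat.succ_le_succ ih
    · rw [pos_succ_of_not_lt h]; simp

/-- If a window of length `m i` fits into the rest of the current block, the hit occurs there.
Otherwise at most `L + 1` steps lead to the next index. From there `ρ` has a hit at most `K` indices
ahead, unless a nontrivial block comes first, which provides one within `L` steps (`base`). The
bound is independent of `T`, so blocks may be arbitrarily long. -/
theorem exists_hit_insert {P : V → Prop} {ρ : ℕ → V} {q : ℕ → ℕ → V} {m : ℕ → ℕ} {L K : ℕ}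
    (hq0 : ∀ i, q i 0 = ρ i) (hm : ∀ i, 0 < T i → m i ≤ T i) (hL : ∀ i, m i ≤ L)
    (hw : ∀ i, 0 < T i → ∀ s, ∃ j < m i, P (q i (s + j)))
    (hρ : ∀ i, ∃ j ≤ K, P (ρ (i + j))) (n : ℕ) :
    ∃ j ≤ L + 1 + (K + L), P (q (pos T (n + j)).1 (pos T (n + j)).2) := by
  have base : ∀ d i n, pos T n = (i, 0) → P (ρ (i + d)) →
      ∃ j ≤ d + L, P (q (pos T (n + j)).1 (pos T (n + j)).2) := by
    intro d
    induction d with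
    | zero => intro i n hn hP; exact ⟨0, by omega, by simpa [hn, hq0] using hP⟩
    | succ d ih =>
      intro i n hn hP
      rcases Nat.eq_zero_or_pos (T i) with h | h
      · have := pos_next hn
        obtain ⟨j, hj, hj'⟩ := ih (i + 1) (n + 1) (by simpa [h] using this)
          (by rwa [Nat.add_assoc, Nat.add_comm 1])
        exact ⟨j + 1, by omega, by rwa [← Nat.add_assoc, Nat.add_right_comm]⟩
      · obtain ⟨j, hj, hj'⟩ := hw i h 0
        have := hm i h
        exact ⟨j, by have := hL i; omega, by rwa [pos_add hn j (by omega)]⟩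
  obtain ⟨i, s, hn⟩ : ∃ i s, pos T n = (i, s) := ⟨_, _, rfl⟩
  have hi := hL i
  by_cases h : 0 < T i ∧ s + m i ≤ T i
  · obtain ⟨j, hj, hj'⟩ := hw i h.1 s
    exact ⟨j, by omega, by rwa [pos_add hn j (by omega)]⟩
  · obtain ⟨d, hd, hP⟩ := hρ (i + 1)
    obtain ⟨j, hj, hj'⟩ := base d _ _ (pos_next hn) hP
    refine ⟨(T i - s) + 1 + j, by omega, ?_⟩
    simpa only [Nat.add_assoc] using hj'

end Insert

/-- A plain step, or a marking step from a vertex with a covering cycle of plain steps. -/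
def MarkedStep (E M : V → V → Prop) (H : κ → V → Prop) (Cl : List κ) (u v : V) : Prop :=
  E u v ∨ (M u v ∧ Covers E H Cl u)

/-- On an infinite path `ρ` into and around the given cycle, the plain covering cycle is run through
`l + 1` times before each step that is not plain. Gaps between visits to `B` depend only on cycle
lengths, so `k` can be fixed before `l`. Visits to `H` are those of `ρ`; their delay may grow with
`l`. -/
theorem exists_long_blocks {E M : V → V → Prop} {B H : κ → V → Prop}
    (hHB : ∀ c v, H c v → B c v) {x₀ x : V}
    (hx : TransGen (MarkedStep E M B Cl) x₀ x) (hc : Covers (MarkedStep E M B Cl) H Cl x) :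
    ∃ k : ℕ, ∀ l : ℕ, ∃ (p : ℕ → V) (b : ℕ → Prop), p 0 = x₀ ∧
      (∀ i, ¬ b i → E (p i) (p (i + 1))) ∧ (∀ i, b i → M (p i) (p (i + 1))) ∧
      (∀ i j, b i → b j → i < j → i + l < j) ∧
      (∀ c ∈ Cl, ∀ i, ∃ j ≤ k, B c (p (i + j))) ∧ ∀ c ∈ Cl, ∀ i, ∃ j, H c (p (i + j)) := by
  classical
  obtain ⟨K, ρ, hfin, hρ0, hstep, hH⟩ := Covers.exists_path hx.to_reflTransGen hc
  have hcyc : ∀ v, ∃ (n : ℕ) (p : ℕ → V), Covers E B Cl v → 0 < n ∧ p 0 = v ∧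
      (∀ i, p (i + n) = p i) ∧ (∀ i, E (p i) (p (i + 1))) ∧
      ∀ c ∈ Cl, ∀ i, ∃ j < n, B c (p (i + j)) := fun v => by
    by_cases h : Covers E B Cl v
    · obtain ⟨n, p, hp⟩ := h.exists_periodic
      exact ⟨n, p, fun _ => hp⟩
    · exact ⟨0, fun _ => v, fun h' => absurd h' h⟩
  choose m cyc hcyc using hcyc
  -- `ρ` meets finitely many vertices, so the inserted cycles have bounded length.
  obtain ⟨L, hL⟩ := (hfin.image m).bddAbove
  refine ⟨L + 1 + (K + L), fun l => ?_⟩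
  let T : ℕ → ℕ := fun i => if E (ρ i) (ρ (i + 1)) then 0 else m (ρ i) * (l + 1)
  let q : ℕ → ℕ → V := fun i s => if E (ρ i) (ρ (i + 1)) then ρ i else cyc (ρ i) s
  have hpump : ∀ i, ¬ E (ρ i) (ρ (i + 1)) → M (ρ i) (ρ (i + 1)) ∧ Covers E B Cl (ρ i) :=
    fun i h => (hstep i).resolve_left h
  have hT0 : ∀ i, 0 < T i → ¬ E (ρ i) (ρ (i + 1)) := fun i h h' => by simp [T, h'] at h
  have hTl : ∀ i, ¬ E (ρ i) (ρ (i + 1)) → l < T i := fun i h => by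
    have := (hcyc _ (hpump i h).2).1
    simp only [T, h, if_false]
    nlinarith
  have hq0 : ∀ i, q i 0 = ρ i := fun i => by
    by_cases h : E (ρ i) (ρ (i + 1))
    · simp [q, h]
    · simp [q, h, (hcyc _ (hpump i h).2).2.1]
  have hqT : ∀ i, q i (T i) = ρ i := fun i => by
    by_cases h : E (ρ i) (ρ (i + 1))
    · simp [q, h]
    · obtain ⟨-, h0, hper, -⟩ := hcyc _ (hpump i h).2
      simp only [q, T, h, if_false]
      rw [Nat.mul_comm]
      simpa [h0] using Function.Periodic.nat_mul (f := cyc (ρ i)) (c := m (ρ i)) hper (l + 1) 0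
  -- The mark is the step out of a nontrivial block, so a whole block lies between two marks.
  refine ⟨fun n => q (pos T n).1 (pos T n).2, fun n => 0 < T (pos T n).1 ∧
    (pos T n).2 = T (pos T n).1, by simp [pos, hq0, hρ0], fun n hn => ?_, ?_, ?_, ?_, ?_⟩
  · beta_reduce
    by_cases h : (pos T n).2 < T (pos T n).1
    · rw [pos_succ_of_lt h]
      have h' := hT0 _ (Nat.zero_lt_of_lt h)
      simpa [q, h'] using (hcyc _ (hpump _ h').2).2.2.2.1 _
    · have h1 := pos_snd_le (T := T) n
      have h2 : T (pos T n).1 = 0 := by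
        by_contra h3
        exact hn ⟨Nat.pos_of_ne_zero h3, by omega⟩
      have h3 : E (ρ (pos T n).1) (ρ ((pos T n).1 + 1)) := by
        by_contra h4
        have := hTl _ h4
        omega
      rw [pos_succ_of_not_lt h]
      simpa only [show (pos T n).2 = 0 by omega, hq0] using h3
  · rintro n ⟨h0, h⟩
    beta_reduce
    rw [pos_succ_of_not_lt (by omega), h, hqT, hq0]
    exact (hpump _ (hT0 _ h0)).1
  · rintro n n' ⟨h0, h⟩ ⟨h0', h'⟩ hlt
    obtain ⟨j, rfl⟩ : ∃ j, n' = n + 1 + j := ⟨n' - (n + 1), by omega⟩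
    have := pos_snd_le_sub (pos_succ_of_not_lt (T := T) (n := n) (by omega)) j
    have := hTl _ (hT0 _ h0')
    omega
  · intro c hc
    refine exists_hit_insert (T := T) (m := fun i => m (ρ i)) hq0 (fun i h => ?_)
      (fun i => hL ⟨_, ⟨i, rfl⟩, rfl⟩) (fun i h s => ?_) (fun i => ?_)
    · simp only [T, hT0 i h, if_false]
      exact Nat.le_mul_of_pos_right _ (by omega)
    · have h' := hT0 i h
      simpa [q, h'] using (hcyc _ (hpump i h').2).2.2.2.2 c hc s
    · obtain ⟨j, hj, hj'⟩ := hH c hc i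
      exact ⟨j, hj, hHB _ _ hj'⟩
  · intro c hc n
    obtain ⟨j, -, hj⟩ := hH c hc ((pos T n).1 + 1)
    obtain ⟨d, hd⟩ := pos_later (T := T) (n := n) rfl j
    exact ⟨d, by simpa [hd, hq0] using hj⟩

/-! ### Finding covering cycles by the pigeonhole principle -/

theorem transGen_of_steps {f : ℕ → V} {i j : ℕ} (hij : i < j)
    (h : ∀ n, i ≤ n → n < j → r (f n) (f (n + 1))) : TransGen r (f i) (f j) := by
  induction j, hij using Nat.le_induction with
  | base => exact .single (h i le_rfl (by omega))
  | succ j hj ih =>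
    exact (ih fun n h₁ h₂ => h n h₁ (by omega)).tail (h j (by omega) (by omega))

/-- Among the `U.ncard + 1` samples `f (a + s * (k + 1))` two coincide. The closed walk between them
has length at least `k + 1`, hence meets every `B c`. -/
theorem exists_covers_of_steps {E : V → V → Prop} {B : κ → V → Prop} {U : Set V} (hU : U.Finite)
    {f : ℕ → V} (hf : ∀ i, f i ∈ U) {a k : ℕ}
    (hE : ∀ i, a ≤ i → i < a + U.ncard * (k + 1) → E (f i) (f (i + 1)))
    (hB : ∀ c ∈ Cl, ∀ i, ∃ j ≤ k, B c (f (i + j))) :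
    ∃ i, a ≤ i ∧ i ≤ a + U.ncard * (k + 1) ∧ Covers E B Cl (f i) := by
  classical
  have hpig : ∃ s s', s < s' ∧ s' ≤ U.ncard ∧ f (a + s * (k + 1)) = f (a + s' * (k + 1)) := by
    obtain ⟨s, hs, s', hs', hne, heq⟩ := Finset.exists_ne_map_eq_of_card_lt_of_maps_to
      (s := Finset.range (U.ncard + 1)) (t := hU.toFinset) (f := fun s => f (a + s * (k + 1)))
      (by rw [Finset.card_range, ← Set.ncard_eq_toFinset_card U hU]; omega)
      (fun s _ => by simpa using hf _)
    simp only [Finset.mem_range] at hs hs'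
    rcases lt_or_gt_of_ne hne with h | h
    · exact ⟨s, s', h, by omega, heq⟩
    · exact ⟨s', s, h, by omega, heq.symm⟩
  obtain ⟨s, s', hlt, hs', heq⟩ := hpig
  have h1 : (s + 1) * (k + 1) ≤ s' * (k + 1) := Nat.mul_le_mul_right _ hlt
  have h2 : s' * (k + 1) ≤ U.ncard * (k + 1) := Nat.mul_le_mul_right _ hs'
  have h3 : (s + 1) * (k + 1) = s * (k + 1) + (k + 1) := by ring
  have hcyc : TransGen E (f (a + s * (k + 1))) (f (a + s * (k + 1))) := by
    conv_rhs => rw [heq]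
    exact transGen_of_steps (by omega) fun n _ _ => hE n (by omega) (by omega)
  refine ⟨a + s * (k + 1), by omega, by omega, hcyc, fun c hc => ?_⟩
  obtain ⟨j, hj, hj'⟩ := hB c hc (a + s * (k + 1))
  refine ⟨_, hj', ?_, ?_⟩
  · rcases Nat.eq_zero_or_pos j with rfl | h
    · exact hcyc
    · exact transGen_of_steps (by omega) fun n _ _ => hE n (by omega) (by omega)
  · rw [heq]
    exact transGen_of_steps (by omega) fun n _ _ => hE n (by omega) (by omega)

/-- The last and the last but one marked position before `i`, when a position is marked as
soon as it satisfies `Q`. -/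
def marks (Q : ℕ → ℕ → ℕ → Prop) [∀ i a b, Decidable (Q i a b)] : ℕ → ℕ × ℕ
  | 0 => (0, 0)
  | i + 1 => if Q i (marks Q i).1 (marks Q i).2 then (i + 1, (marks Q i).1) else marks Q i

/-- A mark is recorded at the end of its step, so a waiting time of at most `N` gives marks at most
`N + 1` apart, and `i` exceeds the last but one mark by at most `2 * N + 1`. The final clause only
serves the induction. -/
theorem marks_bounds {Q : ℕ → ℕ → ℕ → Prop} [∀ i a b, Decidable (Q i a b)] {N : ℕ}
    (hQ : ∀ a b, b ≤ a → a ≤ b + (N + 1) → ∃ i, a ≤ i ∧ i ≤ a + N ∧ Q i a b) (i : ℕ) :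
    (marks Q i).2 ≤ (marks Q i).1 ∧ (marks Q i).1 ≤ i ∧ i ≤ (marks Q i).1 + N ∧
      (marks Q i).1 ≤ (marks Q i).2 + (N + 1) ∧
      ∀ j, (marks Q i).1 ≤ j → j < i → ¬ Q j (marks Q i).1 (marks Q i).2 := by
  induction i with
  | zero => exact ⟨le_rfl, le_rfl, Nat.zero_le _, Nat.zero_le _, fun _ _ h => absurd h (by omega)⟩
  | succ i ih =>
    obtain ⟨h1, h2, h3, h4, h5⟩ := ih
    by_cases h : Q i (marks Q i).1 (marks Q i).2
    · rw [marks, if_pos h]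
      exact ⟨by simp only; omega, le_rfl, by simp only; omega, by simp only; omega,
        fun j h6 h7 => absurd h7 (by simp only at h6; omega)⟩
    · rw [marks, if_neg h]
      have h6 : ∀ j, (marks Q i).1 ≤ j → j < i + 1 → ¬ Q j (marks Q i).1 (marks Q i).2 := by
        intro j hj hj'
        rcases (Nat.lt_succ_iff.1 hj').lt_or_eq with h7 | rfl
        · exact h5 j hj h7
        · exact h
      refine ⟨h1, by omega, ?_, h4, h6⟩
      obtain ⟨j, hj, hj', hj''⟩ := hQ _ _ h1 h4
      by_contra h7
      exact h6 j hj (by omega) hj''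

/-- `S i a b` is the vertex at time `i` when the last two marks are `a` and `b`. Marking greedily
keeps `i ≤ b + l`, so `hE` and `hM` apply and give an infinite path in `U`; `x` is a vertex that
recurs infinitely often. In `hB` and `hH` the time is chosen before `a` and `b`, because the marks
depend on the path. -/
theorem exists_covers_markedStep {E M : V → V → Prop} {B H : κ → V → Prop} {U : Set V}
    (hU : U.Finite) {S : ℕ → ℕ → ℕ → V} {k l : ℕ} (hS : ∀ i a b, S i a b ∈ U)
    (hl : 2 * (U.ncard * (k + 1)) + 1 ≤ l)
    (hE : ∀ i a b, b ≤ a → a ≤ i → i ≤ b + l → E (S i a b) (S (i + 1) a b))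
    (hM : ∀ i a b, b ≤ a → a ≤ i → i ≤ b + l → M (S i a b) (S (i + 1) (i + 1) a))
    (hB : ∀ c ∈ Cl, ∀ i, ∃ j ≤ k, ∀ a b, B c (S (i + j) a b))
    (hH : ∀ c ∈ Cl, ∀ i, ∃ j, ∀ a b, H c (S (i + j) a b)) :
    ∃ x ∈ U, TransGen (MarkedStep E M B Cl) (S 0 0 0) x ∧
      Covers (MarkedStep E M B Cl) H Cl x := by
  classical
  let Q : ℕ → ℕ → ℕ → Prop := fun i a b => Covers E B Cl (S i a b)
  let f : ℕ → V := fun i => S i (marks Q i).1 (marks Q i).2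
  have hmarks := marks_bounds (Q := Q) (N := U.ncard * (k + 1)) fun a b hba hab => by
    refine exists_covers_of_steps (f := fun i => S i a b) hU (fun i => hS _ _ _)
      (fun i h1 h2 => hE i a b hba h1 (by omega)) fun c hc i => ?_
    obtain ⟨j, hj, hj'⟩ := hB c hc i
    exact ⟨j, hj, hj' a b⟩
  have hstep : ∀ i, MarkedStep E M B Cl (f i) (f (i + 1)) := fun i => by
    obtain ⟨h1, h2, h3, h4, -⟩ := hmarks i
    by_cases h : Q i (marks Q i).1 (marks Q i).2
    · right
      simp only [f]
      rw [marks, if_pos h]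
      exact ⟨hM i _ _ h1 h2 (by omega), h⟩
    · left
      simp only [f]
      rw [marks, if_neg h]
      exact hE i _ _ h1 h2 (by omega)
  have htrans : ∀ {i j}, i < j → TransGen (MarkedStep E M B Cl) (f i) (f j) := fun h =>
    transGen_of_steps h fun n _ _ => hstep n
  have := hU.to_subtype
  obtain ⟨⟨x, hxU⟩, hx⟩ :=
    Finite.exists_infinite_fiber fun i => (⟨f i, hS _ _ _⟩ : U)
  have hx : ∀ n, ∃ i, n < i ∧ f i = x := fun n => by
    obtain ⟨i, hi, hi'⟩ := (Set.infinite_coe_iff.1 hx).exists_gt n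
    exact ⟨i, hi', by simpa using hi⟩
  obtain ⟨i, hi, rfl⟩ := hx 0
  refine ⟨_, hxU, htrans hi, ?_, fun c hc => ?_⟩
  · obtain ⟨i', hi', h⟩ := hx i
    simpa [h] using htrans hi'
  · obtain ⟨j, hj⟩ := hH c hc (i + 1)
    obtain ⟨i', hi', h⟩ := hx (i + 1 + j)
    exact ⟨f (i + 1 + j), hj _ _, htrans (by omega), h ▸ htrans hi'⟩

end CycleCover

/-! ### A tableau for pairs of bounds -/

namespace PromptLTL

variable {σ : Type*}

/-- A formula in textual form together with a sign: `(true, φ)` claims that `φ` holds with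
respect to a first bound, `(false, φ)` that `φ` fails with respect to a second one. -/
abbrev Claim (σ : Type*) := Bool × List (Symb σ)

/-- `c` is a positive claim with operator `o₁` or a negative claim with operator `o₂`. -/
def Claim.Is (c : Claim σ) (o₁ o₂ : Fin 6) (t : List (Symb σ)) : Prop :=
  c = (true, Sum.inr o₁ :: t) ∨ c = (false, Sum.inr o₂ :: t)

/-- The claim `c` is true at position `i` of `w`. -/
def Claim.Holds (w : ℕ → Set σ) (k l : ℕ) (c : Claim σ) (i : ℕ) : Prop :=
  ∃ φ : PromptLTL σ, c.2 = φ.text ∧ (c.1 = true → φ.Sat w k i) ∧ (c.1 = false → ¬ φ.Sat w l i)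

theorem Claim.holds_iff {w : ℕ → Set σ} {k l i : ℕ} {s : Bool} {φ : PromptLTL σ} :
    Claim.Holds w k l (s, φ.text) i ↔ (s = true → φ.Sat w k i) ∧ (s = false → ¬ φ.Sat w l i) :=
  ⟨fun ⟨_, h, h'⟩ => text_injective h ▸ h', fun h => ⟨φ, rfl, h⟩⟩

/-- `Cl` consists of claims about formulas and contains the claims about the direct
subformulas of its members. -/
def SubClosed (Cl : List (Claim σ)) : Prop :=
  ∀ c ∈ Cl, (∃ x ∈ c.2, c.2 = [x] ∧ x.isLeft = true) ∨
    (∃ c₁ ∈ Cl, c₁.1 = c.1 ∧ (c.2 = Sum.inr 2 :: c₁.2 ∨ c.2 = Sum.inr 5 :: c₁.2)) ∨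
    ∃ c₁ ∈ Cl, ∃ c₂ ∈ Cl, (c₁.1 = c.1 ∧ c₂.1 = c.1) ∧
      ∃ o ∈ [(0 : Fin 6), 1, 3, 4], c.2 = Sum.inr o :: (c₁.2 ++ c₂.2)

/-- Every clause for an operator leads to shorter strings, so induction on the length applies. A
sub-closed list thus certifies that its strings are formulas, and no parser is needed. -/
theorem SubClosed.exists_text {Cl : List (Claim σ)} (h : SubClosed Cl) {c : Claim σ}
    (hc : c ∈ Cl) : ∃ φ : PromptLTL σ, c.2 = φ.text := by
  induction hn : c.2.length using Nat.strong_induction_on generalizing c with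
  | _ n ih =>
  subst hn
  rcases h c hc with ⟨x, -, hx, hl⟩ | ⟨c₁, h₁, -, ho⟩ | ⟨c₁, h₁, c₂, h₂, -, o, ho, hx⟩
  · rcases x with ⟨b, a⟩ | _
    · exact ⟨lit b a, hx⟩
    · simp at hl
  · obtain ⟨φ, hφ⟩ := ih _ (by rcases ho with h | h <;> simp [h]) h₁ rfl
    rcases ho with ho | ho
    · exact ⟨next φ, by rw [ho, hφ, text]⟩
    · exact ⟨prompt φ, by rw [ho, hφ, text]⟩
  · obtain ⟨φ, hφ⟩ := ih _ (by simp [hx]) h₁ rfl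
    obtain ⟨ψ, hψ⟩ := ih _ (by simp [hx]) h₂ rfl
    simp only [List.mem_cons, List.not_mem_nil, or_false] at ho
    rcases ho with rfl | rfl | rfl | rfl
    · exact ⟨and φ ψ, by rw [hx, hφ, hψ, text]⟩
    · exact ⟨or φ ψ, by rw [hx, hφ, hψ, text]⟩
    · exact ⟨untl φ ψ, by rw [hx, hφ, hψ, text]⟩
    · exact ⟨release φ ψ, by rw [hx, hφ, hψ, text]⟩

theorem SubClosed.unary {Cl : List (Claim σ)} (h : SubClosed Cl) {s : Bool} {o : Fin 6}
    {φ : PromptLTL σ} (ho : o = 2 ∨ o = 5) (hc : (s, Sum.inr o :: φ.text) ∈ Cl) :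
    (s, φ.text) ∈ Cl := by
  rcases h _ hc with ⟨x, -, hx, hl⟩ | ⟨c₁, h₁, hs, ho'⟩ | ⟨c₁, h₁, c₂, h₂, -, o', ho', hx⟩
  · simp only [List.cons.injEq] at hx
    simp [← hx.1] at hl
  · have : c₁.2 = φ.text := by
      rcases ho' with h | h <;> exact (List.cons.inj h).2.symm
    rw [← this]
    simp only at hs
    rwa [← hs]
  · simp only [List.cons.injEq, Sum.inr.injEq] at hx
    rcases ho with rfl | rfl <;> simp [← hx.1] at ho'

/-- By unique readability (`text_append_inj`) the splitting provided by `SubClosed` is the expected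
one. -/
theorem SubClosed.binary {Cl : List (Claim σ)} (h : SubClosed Cl) {s : Bool} {o : Fin 6}
    {φ ψ : PromptLTL σ} (ho : o ∈ [(0 : Fin 6), 1, 3, 4])
    (hc : (s, Sum.inr o :: (φ.text ++ ψ.text)) ∈ Cl) :
    (s, φ.text) ∈ Cl ∧ (s, ψ.text) ∈ Cl := by
  rcases h _ hc with ⟨x, -, hx, hl⟩ | ⟨c₁, h₁, hs, ho'⟩ | ⟨c₁, h₁, c₂, h₂, hs, o', ho', hx⟩
  · simp only [List.cons.injEq] at hx
    simp [← hx.1] at hl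
  · simp only [List.cons.injEq, Sum.inr.injEq] at ho'
    rcases ho' with h | h <;> simp [h.1] at ho
  · obtain ⟨φ', hφ⟩ := h.exists_text h₁
    obtain ⟨ψ', hψ⟩ := h.exists_text h₂
    simp only [List.cons.injEq, hφ, hψ] at hx
    obtain ⟨rfl, hx'⟩ := text_append_inj _ _ _ _ hx.2
    obtain rfl := text_injective hx'
    simp only at hs
    rw [← hφ, ← hψ]
    exact ⟨by rw [← hs.1]; exact h₁, by rw [← hs.2]; exact h₂⟩

/-- The literal `x` has truth value `s` in the letter `w`. -/
def LitHolds (w : List σ) (s : Bool) : Symb σ → Prop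
  | Sum.inl x => x.2 ∈ w ↔ x.1 = s
  | Sum.inr _ => True

/-- The local conditions between the claims `X` made and the older claims `D` kept at one
position and those at the next. Negative prompt claims are kept until the second step with
`mark = true` after they were made. -/
def Tableau (Cl : List (Claim σ)) (mark : Bool) (w : List σ) (X D X' D' : List (Claim σ)) : Prop :=
  (∀ c ∈ X, ∀ x ∈ c.2, c.2 = [x] → LitHolds w c.1 x) ∧
  (∀ c ∈ X, ∀ c₁ ∈ Cl, c₁.1 = c.1 →
    (c.2 = Sum.inr 2 :: c₁.2 → c₁ ∈ X') ∧
    (c = (true, Sum.inr 5 :: c₁.2) → c₁ ∈ X ∨ c ∈ X') ∧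
    (c = (false, Sum.inr 5 :: c₁.2) → c₁ ∈ X ∧ (c ∈ X' ∨ (mark = true ∧ c ∈ D'))) ∧
    ∀ c₂ ∈ Cl, c₂.1 = c.1 →
      (c.Is 0 1 (c₁.2 ++ c₂.2) → c₁ ∈ X ∧ c₂ ∈ X) ∧
      (c.Is 1 0 (c₁.2 ++ c₂.2) → c₁ ∈ X ∨ c₂ ∈ X) ∧
      (c.Is 3 4 (c₁.2 ++ c₂.2) → c₂ ∈ X ∨ (c₁ ∈ X ∧ c ∈ X')) ∧
      (c.Is 4 3 (c₁.2 ++ c₂.2) → c₂ ∈ X ∧ (c₁ ∈ X ∨ c ∈ X'))) ∧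
  ∀ c ∈ D, ∀ c₁ ∈ Cl, c₁.1 = c.1 → c = (false, Sum.inr 5 :: c₁.2) →
    c₁ ∈ X ∧ (mark = false → c ∈ D')

/-- If `c` is a positive prompt claim in `X`, then its subformula is claimed as well. -/
def PromptHit (Cl : List (Claim σ)) (c : Claim σ) (X : List (Claim σ)) : Prop :=
  ∀ c₁ ∈ Cl, c₁.1 = c.1 → c = (true, Sum.inr 5 :: c₁.2) → c ∉ X ∨ c₁ ∈ X

/-- If `c` is an eventuality in `X`, then its target is claimed as well. -/
def Hit (Cl : List (Claim σ)) (c : Claim σ) (X : List (Claim σ)) : Prop :=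
  PromptHit Cl c X ∧ ∀ c₁ ∈ Cl, ∀ c₂ ∈ Cl, c₁.1 = c.1 → c₂.1 = c.1 →
    c.Is 3 4 (c₁.2 ++ c₂.2) → c ∉ X ∨ c₂ ∈ X

theorem Tableau.weaken {Cl : List (Claim σ)} {w : List σ} {X D X' D' : List (Claim σ)}
    (h : Tableau Cl false w X D X' D') : Tableau Cl true w X D X' D' := by
  refine ⟨h.1, fun c hc c₁ h₁ hs => ?_, fun c hc c₁ h₁ hs he => ⟨(h.2.2 c hc c₁ h₁ hs he).1, by simp⟩⟩
  obtain ⟨h2, h3, h4, h5⟩ := h.2.1 c hc c₁ h₁ hs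
  exact ⟨h2, h3, fun he => ⟨(h4 he).1, (h4 he).2.imp_right fun h => by simp at h⟩, h5⟩

/-! ### Claims along a path with sparse marks are true -/

section Soundness

variable {Cl : List (Claim σ)} {W : ℕ → List σ} {X D : ℕ → List (Claim σ)} {b : ℕ → Prop}
  {c c₁ c₂ : Claim σ} {i : ℕ}

/-- `c.Is 3 4` covers a positive until and a negated release alike. The claim is handed on until its
target is claimed, and `hH` excludes that it is handed on forever. -/
theorem until_of_tableau
    (hT : ∀ i, Tableau Cl true (W i) (X i) (D i) (X (i + 1)) (D (i + 1)))
    (hH : ∀ c ∈ Cl, ∀ i, ∃ j, Hit Cl c (X (i + j))) (hc : c ∈ Cl)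
    (h₁ : c₁ ∈ Cl) (h₂ : c₂ ∈ Cl) (s₁ : c₁.1 = c.1) (s₂ : c₂.1 = c.1)
    (he : c.Is 3 4 (c₁.2 ++ c₂.2)) (hi : c ∈ X i) :
    ∃ j, c₂ ∈ X (i + j) ∧ ∀ m < j, c₁ ∈ X (i + m) := by
  classical
  have hex : ∃ j, c ∉ X (i + j) ∨ c₂ ∈ X (i + j) := by
    obtain ⟨j, hj⟩ := hH c hc i
    exact ⟨j, hj.2 c₁ h₁ c₂ h₂ s₁ s₂ he⟩
  have hstep : ∀ j, c ∈ X (i + j) → c₂ ∈ X (i + j) ∨ (c₁ ∈ X (i + j) ∧ c ∈ X (i + (j + 1))) :=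
    fun j hj => (((hT _).2.1 c hj c₁ h₁ s₁).2.2.2 c₂ h₂ s₂).2.2.1 he
  have hlt : ∀ m < Nat.find hex, c₁ ∈ X (i + m) ∧ c ∈ X (i + (m + 1)) := fun m hm => by
    have := Nat.find_min hex hm
    push Not at this
    exact (hstep m this.1).resolve_left this.2
  refine ⟨Nat.find hex, (Nat.find_spec hex).resolve_left (not_not.2 ?_), fun m hm => (hlt m hm).1⟩
  rcases hn : Nat.find hex with _ | n
  · exact hi
  · exact (hlt n (by omega)).2

theorem release_of_tableau
    (hT : ∀ i, Tableau Cl true (W i) (X i) (D i) (X (i + 1)) (D (i + 1)))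
    (h₁ : c₁ ∈ Cl) (h₂ : c₂ ∈ Cl) (s₁ : c₁.1 = c.1) (s₂ : c₂.1 = c.1)
    (he : c.Is 4 3 (c₁.2 ++ c₂.2)) (hi : c ∈ X i) (j : ℕ) :
    c₂ ∈ X (i + j) ∨ ∃ m < j, c₁ ∈ X (i + m) := by
  have hstep : ∀ j, c ∈ X (i + j) → c₂ ∈ X (i + j) ∧ (c₁ ∈ X (i + j) ∨ c ∈ X (i + (j + 1))) :=
    fun j hj => (((hT _).2.1 c hj c₁ h₁ s₁).2.2.2 c₂ h₂ s₂).2.2.2 he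
  have : c ∈ X (i + j) ∨ ∃ m < j, c₁ ∈ X (i + m) := by
    induction j with
    | zero => exact Or.inl hi
    | succ j ih =>
      rcases ih with h | ⟨m, hm, h⟩
      · rcases (hstep j h).2 with h | h
        · exact Or.inr ⟨j, by omega, h⟩
        · exact Or.inl h
      · exact Or.inr ⟨m, by omega, h⟩
  exact this.imp_left fun h => (hstep j h).1

theorem prompt_of_tableau {k : ℕ}
    (hT : ∀ i, Tableau Cl true (W i) (X i) (D i) (X (i + 1)) (D (i + 1)))
    (hP : ∀ c ∈ Cl, ∀ i, ∃ j ≤ k, PromptHit Cl c (X (i + j))) (hc : c ∈ Cl)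
    (h₁ : c₁ ∈ Cl) (s₁ : c₁.1 = c.1) (he : c = (true, Sum.inr 5 :: c₁.2)) (hi : c ∈ X i) :
    ∃ j ≤ k, c₁ ∈ X (i + j) := by
  classical
  obtain ⟨j₀, hj₀, hj₀'⟩ := hP c hc i
  have hex : ∃ j, c ∉ X (i + j) ∨ c₁ ∈ X (i + j) := ⟨j₀, hj₀' c₁ h₁ s₁ he⟩
  have hle : Nat.find hex ≤ k := (Nat.find_min' hex (hj₀' c₁ h₁ s₁ he)).trans hj₀
  refine ⟨Nat.find hex, hle, (Nat.find_spec hex).resolve_left (not_not.2 ?_)⟩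
  rcases hn : Nat.find hex with _ | n
  · exact hi
  · have := Nat.find_min hex (show n < Nat.find hex by omega)
    push Not at this
    exact (((hT _).2.1 c this.1 c₁ h₁ s₁).2.1 he).resolve_left this.2

/-- The claim stays in `X` up to a mark and then in `D` up to the next one, forcing `c₁` all the
time. Two marks do not fit into the steps from `i` to `i + l`, so it is not dropped too early. -/
theorem not_prompt_of_tableau {l : ℕ}
    (hT : ∀ i, Tableau Cl true (W i) (X i) (D i) (X (i + 1)) (D (i + 1)))
    (hT' : ∀ i, ¬ b i → Tableau Cl false (W i) (X i) (D i) (X (i + 1)) (D (i + 1)))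
    (hb : ∀ i j, b i → b j → i < j → i + l < j)
    (h₁ : c₁ ∈ Cl) (s₁ : c₁.1 = c.1) (he : c = (false, Sum.inr 5 :: c₁.2)) (hi : c ∈ X i)
    (j : ℕ) (hj : j ≤ l) : c₁ ∈ X (i + j) := by
  have : c ∈ X (i + j) ∨ (c ∈ D (i + j) ∧ ∃ m < j, b (i + m)) := by
    induction j with
    | zero => exact Or.inl hi
    | succ j ih =>
      rcases ih (by omega) with h | ⟨h, m, hm, hbm⟩
      · by_cases hbj : b (i + j)
        · exact (((hT _).2.1 c h c₁ h₁ s₁).2.2.1 he).2.imp_right fun h => ⟨h.2, j, by omega, hbj⟩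
        · exact (((hT' _ hbj).2.1 c h c₁ h₁ s₁).2.2.1 he).2.imp_right fun h => by simp at h
      · have hbj : ¬ b (i + j) := fun h => by
          have := hb _ _ hbm h (by omega)
          omega
        exact Or.inr ⟨((hT' _ hbj).2.2 c h c₁ h₁ s₁ he).2 rfl, m, by omega, hbm⟩
  rcases this with h | h
  · exact (((hT _).2.1 c h c₁ h₁ s₁).2.2.1 he).1
  · exact ((hT _).2.2 c h.1 c₁ h₁ s₁ he).1

/-- Both signs are handled in one induction on the formula. The bound `k` enters only through `hP`,
the bound `l` only through `hb`. -/
theorem holds_of_tableau (hCl : SubClosed Cl) {k l : ℕ}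
    (hT : ∀ i, Tableau Cl true (W i) (X i) (D i) (X (i + 1)) (D (i + 1)))
    (hT' : ∀ i, ¬ b i → Tableau Cl false (W i) (X i) (D i) (X (i + 1)) (D (i + 1)))
    (hb : ∀ i j, b i → b j → i < j → i + l < j)
    (hP : ∀ c ∈ Cl, ∀ i, ∃ j ≤ k, PromptHit Cl c (X (i + j)))
    (hH : ∀ c ∈ Cl, ∀ i, ∃ j, Hit Cl c (X (i + j))) (φ : PromptLTL σ) :
    ∀ (s : Bool) (i : ℕ), (s, φ.text) ∈ Cl → (s, φ.text) ∈ X i →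
      (s = true → φ.Sat (fun n => {a | a ∈ W n}) k i) ∧
      (s = false → ¬ φ.Sat (fun n => {a | a ∈ W n}) l i) := by
  induction φ with
  | lit p a =>
    intro s i hc hi
    have : a ∈ W i ↔ p = s := (hT i).1 _ hi (Sum.inl (p, a)) (by simp [text]) rfl
    cases s <;> cases p <;> simp_all [Sat]
  | and φ ψ ih₁ ih₂ =>
    intro s i hc hi
    obtain ⟨h₁, h₂⟩ := hCl.binary (by simp) hc
    have := ((hT i).2.1 _ hi _ h₁ rfl).2.2.2 _ h₂ rfl
    cases s
    · refine ⟨by simp, fun _ ⟨g₁, g₂⟩ => ?_⟩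
      rcases this.2.1 (Or.inr rfl) with h | h
      · exact (ih₁ _ _ h₁ h).2 rfl g₁
      · exact (ih₂ _ _ h₂ h).2 rfl g₂
    · have h := this.1 (Or.inl rfl)
      exact ⟨fun _ => ⟨(ih₁ _ _ h₁ h.1).1 rfl, (ih₂ _ _ h₂ h.2).1 rfl⟩, by simp⟩
  | or φ ψ ih₁ ih₂ =>
    intro s i hc hi
    obtain ⟨h₁, h₂⟩ := hCl.binary (by simp) hc
    have := ((hT i).2.1 _ hi _ h₁ rfl).2.2.2 _ h₂ rfl
    cases s
    · have h := this.1 (Or.inr rfl)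
      refine ⟨by simp, fun _ g => ?_⟩
      rcases g with g | g
      · exact (ih₁ _ _ h₁ h.1).2 rfl g
      · exact (ih₂ _ _ h₂ h.2).2 rfl g
    · refine ⟨fun _ => ?_, by simp⟩
      rcases this.2.1 (Or.inl rfl) with h | h
      · exact Or.inl ((ih₁ _ _ h₁ h).1 rfl)
      · exact Or.inr ((ih₂ _ _ h₂ h).1 rfl)
  | next φ ih =>
    intro s i hc hi
    have h₁ := hCl.unary (Or.inl rfl) hc
    exact ih _ _ h₁ (((hT i).2.1 _ hi _ h₁ rfl).1 rfl)
  | untl φ ψ ih₁ ih₂ =>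
    intro s i hc hi
    obtain ⟨h₁, h₂⟩ := hCl.binary (by simp) hc
    cases s
    · have h := release_of_tableau (c := (false, (untl φ ψ).text)) hT h₁ h₂ rfl rfl (Or.inr rfl) hi
      refine ⟨by simp, fun _ ⟨j, g₁, g₂⟩ => ?_⟩
      rcases h j with h | ⟨m, hm, h⟩
      · exact (ih₂ _ _ h₂ h).2 rfl g₁
      · exact (ih₁ _ _ h₁ h).2 rfl (g₂ m hm)
    · obtain ⟨j, h, h'⟩ := until_of_tableau hT hH hc h₁ h₂ rfl rfl (Or.inl rfl) hi
      exact ⟨fun _ => ⟨j, (ih₂ _ _ h₂ h).1 rfl, fun m hm => (ih₁ _ _ h₁ (h' m hm)).1 rfl⟩, by simp⟩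
  | release φ ψ ih₁ ih₂ =>
    intro s i hc hi
    obtain ⟨h₁, h₂⟩ := hCl.binary (by simp) hc
    cases s
    · obtain ⟨j, h, h'⟩ := until_of_tableau hT hH hc h₁ h₂ rfl rfl (Or.inr rfl) hi
      refine ⟨by simp, fun _ g => ?_⟩
      rcases g j with g | ⟨m, hm, g⟩
      · exact (ih₂ _ _ h₂ h).2 rfl g
      · exact (ih₁ _ _ h₁ (h' m hm)).2 rfl g
    · have h := release_of_tableau (c := (true, (release φ ψ).text)) hT h₁ h₂ rfl rfl (Or.inl rfl) hi
      refine ⟨fun _ j => ?_, by simp⟩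
      rcases h j with h | ⟨m, hm, h⟩
      · exact Or.inl ((ih₂ _ _ h₂ h).1 rfl)
      · exact Or.inr ⟨m, hm, (ih₁ _ _ h₁ h).1 rfl⟩
  | prompt φ ih =>
    intro s i hc hi
    have h₁ := hCl.unary (Or.inr rfl) hc
    cases s
    · exact ⟨by simp, fun _ ⟨j, hj, g⟩ =>
        (ih _ _ h₁ (not_prompt_of_tableau (c := (false, (prompt φ).text)) hT hT' hb h₁ rfl rfl hi j hj)).2 rfl g⟩
    · obtain ⟨j, hj, h⟩ := prompt_of_tableau hT hP hc h₁ rfl rfl hi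
      exact ⟨fun _ => ⟨j, hj, (ih _ _ h₁ h).1 rfl⟩, by simp⟩

end Soundness

/-! ### The true claims of a word satisfy the tableau -/

section Completeness

variable {w : ℕ → Set σ} {k l n i a b : ℕ} {Cl : List (Claim σ)} {φ ψ : PromptLTL σ}

theorem sat_untl_iff : (untl φ ψ).Sat w k n ↔
    ψ.Sat w k n ∨ (φ.Sat w k n ∧ (untl φ ψ).Sat w k (n + 1)) := by
  constructor
  · rintro ⟨_ | j, h, h'⟩
    · exact Or.inl h
    · refine Or.inr ⟨h' 0 (by omega), j, ?_, fun m hm => ?_⟩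
      · rwa [Nat.add_assoc, Nat.add_comm 1]
      · rw [Nat.add_assoc, Nat.add_comm 1]
        exact h' _ (by omega)
  · rintro (h | ⟨h, j, hj, h'⟩)
    · exact ⟨0, h, by simp⟩
    · refine ⟨j + 1, by rwa [Nat.add_comm j, ← Nat.add_assoc], fun m hm => ?_⟩
      cases m with
      | zero => exact h
      | succ m =>
        rw [Nat.add_comm m, ← Nat.add_assoc]
        exact h' m (by omega)

theorem sat_release_iff : (release φ ψ).Sat w k n ↔
    ψ.Sat w k n ∧ (φ.Sat w k n ∨ (release φ ψ).Sat w k (n + 1)) := by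
  constructor
  · intro h
    refine ⟨(h 0).resolve_right (by simp), or_iff_not_imp_left.2 fun h' j => ?_⟩
    rcases h (j + 1) with g | ⟨_ | m, hm, g⟩
    · left
      rwa [Nat.add_assoc, Nat.add_comm 1]
    · exact absurd g h'
    · exact Or.inr ⟨m, by omega, by rwa [Nat.add_assoc, Nat.add_comm 1]⟩
  · rintro ⟨h, h'⟩ j
    cases j with
    | zero => exact Or.inl h
    | succ j =>
      rcases h' with h' | h'
      · exact Or.inr ⟨0, by omega, h'⟩
      · rcases h' j with g | ⟨m, hm, g⟩
        · left
          rwa [Nat.add_comm j, ← Nat.add_assoc]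
        · exact Or.inr ⟨m + 1, by omega, by rwa [Nat.add_comm m, ← Nat.add_assoc]⟩

theorem sat_prompt_step (h : (prompt φ).Sat w k n) :
    φ.Sat w k n ∨ (prompt φ).Sat w k (n + 1) := by
  obtain ⟨_ | j, hj, h⟩ := h
  · exact Or.inl h
  · exact Or.inr ⟨j, by omega, by rwa [Nat.add_assoc, Nat.add_comm 1]⟩

/-- Negative prompt claims. -/
def Claim.IsNotPrompt (c : Claim σ) : Prop := ∃ t, c = (false, Sum.inr 5 :: t)

open Classical in
/-- The claims of `Cl` that are true at `i`, and the negative prompt claims that were true at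
some position between `a` and `i`. -/
noncomputable def claimsAt (Cl : List (Claim σ)) (w : ℕ → Set σ) (k l i a : ℕ) :
    List (Claim σ) :=
  Cl.filter fun c => c.Holds w k l i ∨ (c.IsNotPrompt ∧ ∃ j, a ≤ j ∧ j ≤ i ∧ c.Holds w k l j)

open Classical in
/-- The negative prompt claims that were true at some position between `b` and `i`. -/
noncomputable def keptAt (Cl : List (Claim σ)) (w : ℕ → Set σ) (k l i b : ℕ) :
    List (Claim σ) :=
  Cl.filter fun c => c.IsNotPrompt ∧ ∃ j, b ≤ j ∧ j ≤ i ∧ c.Holds w k l j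

theorem mem_claimsAt {c : Claim σ} : c ∈ claimsAt Cl w k l i a ↔ c ∈ Cl ∧ (c.Holds w k l i ∨
    (c.IsNotPrompt ∧ ∃ j, a ≤ j ∧ j ≤ i ∧ c.Holds w k l j)) := by
  simp [claimsAt]

theorem mem_keptAt {c : Claim σ} : c ∈ keptAt Cl w k l i b ↔
    c ∈ Cl ∧ c.IsNotPrompt ∧ ∃ j, b ≤ j ∧ j ≤ i ∧ c.Holds w k l j := by
  simp [keptAt]

theorem holds_of_mem_claimsAt {c : Claim σ} (h : c ∈ claimsAt Cl w k l i a)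
    (hc : ¬ c.IsNotPrompt) : c.Holds w k l i :=
  (mem_claimsAt.1 h).2.resolve_right fun h => hc h.1

/-- Position `i` still lies in the window `[j, j + l]` of which the claim at `j` speaks. This is why
remembering a claim for up to `l` steps is harmless. -/
theorem Claim.Holds.of_not_prompt {j : ℕ}
    (h : Claim.Holds w k l (false, Sum.inr 5 :: φ.text) j) (hj : j ≤ i) (hi : i ≤ j + l) :
    Claim.Holds w k l (false, φ.text) i := by
  have := (Claim.holds_iff (φ := prompt φ)).1 h
  refine Claim.holds_iff.2 ⟨by simp, fun _ g => this.2 rfl ⟨i - j, by omega, ?_⟩⟩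
  rwa [Nat.add_sub_cancel' hj]

/-- Plain and marking steps differ only in where negated prompt claims go, which is isolated in `hN`
and `hD`. Listed claims that may have become false are negated prompt claims made since `b`; by `i ≤
b + l` what they force at `i` is still true. -/
theorem tableau_of_holds (hCl : SubClosed Cl) {W : ℕ → List σ} (hw : w = fun n => {a | a ∈ W n})
    (hba : b ≤ a) (hi : i ≤ b + l) {mark : Bool} {X' D' : List (Claim σ)}
    (hX' : ∀ c ∈ Cl, c.Holds w k l (i + 1) → c ∈ X')
    (hN : ∀ c ∈ claimsAt Cl w k l i a, c.IsNotPrompt → c ∈ X' ∨ (mark = true ∧ c ∈ D'))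
    (hD : mark = false → ∀ c ∈ keptAt Cl w k l i b, c ∈ D') :
    Tableau Cl mark (W i) (claimsAt Cl w k l i a) (keptAt Cl w k l i b) X' D' := by
  have hX : ∀ c ∈ Cl, c.Holds w k l i → c ∈ claimsAt Cl w k l i a :=
    fun c hc h => mem_claimsAt.2 ⟨hc, Or.inl h⟩
  refine ⟨?_, ?_, ?_⟩
  · rintro ⟨s, t⟩ hc x - rfl
    rcases x with ⟨p, x⟩ | _
    · have := holds_of_mem_claimsAt hc (by rintro ⟨t, ht⟩; simp at ht)
      have := (Claim.holds_iff (φ := lit p x)).1 this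
      cases s <;> cases p <;> simp_all [Sat, LitHolds]
    · trivial
  · rintro ⟨s, t⟩ hc ⟨s₁, t₁⟩ h₁ hs
    obtain rfl : s₁ = s := hs
    obtain ⟨φ, hφ⟩ := hCl.exists_text h₁
    obtain rfl : t₁ = φ.text := hφ
    have hcCl := (mem_claimsAt.1 hc).1
    refine ⟨?_, ?_, ?_, ?_⟩
    · rintro rfl
      have := holds_of_mem_claimsAt hc (by rintro ⟨t, ht⟩; simp at ht)
      have := (Claim.holds_iff (φ := next φ)).1 this
      exact hX' _ h₁ (Claim.holds_iff.2 this)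
    · intro he
      simp only [Prod.mk.injEq] at he
      obtain ⟨rfl, rfl⟩ := he
      have := holds_of_mem_claimsAt hc (by rintro ⟨t, ht⟩; simp at ht)
      have := (Claim.holds_iff (φ := prompt φ)).1 this
      rcases sat_prompt_step (this.1 rfl) with h | h
      · exact Or.inl (hX _ h₁ (Claim.holds_iff.2 ⟨fun _ => h, by simp⟩))
      · exact Or.inr (hX' _ hcCl ((Claim.holds_iff (φ := prompt φ)).2 ⟨fun _ => h, by simp⟩))
    · intro he
      simp only [Prod.mk.injEq] at he
      obtain ⟨rfl, rfl⟩ := he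
      refine ⟨hX _ h₁ ?_, hN _ hc ⟨_, rfl⟩⟩
      rcases (mem_claimsAt.1 hc).2 with h | ⟨-, j, hj, hj', h⟩
      · exact h.of_not_prompt le_rfl (by omega)
      · exact h.of_not_prompt hj' (by omega)
    · rintro ⟨s₂, t₂⟩ h₂ hs
      obtain rfl : s₂ = s₁ := hs
      obtain ⟨ψ, hψ⟩ := hCl.exists_text h₂
      obtain rfl : t₂ = ψ.text := hψ
      refine ⟨?_, ?_, ?_, ?_⟩ <;> rintro (he | he) <;> simp only [Prod.mk.injEq] at he <;>
        obtain ⟨rfl, rfl⟩ := he <;>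
        have hh := holds_of_mem_claimsAt hc (by rintro ⟨t, ht⟩; simp at ht)
      · have h := ((Claim.holds_iff (φ := and φ ψ)).1 hh).1 rfl
        exact ⟨hX _ h₁ (Claim.holds_iff.2 ⟨fun _ => h.1, by simp⟩),
          hX _ h₂ (Claim.holds_iff.2 ⟨fun _ => h.2, by simp⟩)⟩
      · have h := ((Claim.holds_iff (φ := or φ ψ)).1 hh).2 rfl
        exact ⟨hX _ h₁ (Claim.holds_iff.2 ⟨by simp, fun _ g => h (Or.inl g)⟩),
          hX _ h₂ (Claim.holds_iff.2 ⟨by simp, fun _ g => h (Or.inr g)⟩)⟩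
      · have h := ((Claim.holds_iff (φ := or φ ψ)).1 hh).1 rfl
        exact h.imp (fun g => hX _ h₁ (Claim.holds_iff.2 ⟨fun _ => g, by simp⟩))
          (fun g => hX _ h₂ (Claim.holds_iff.2 ⟨fun _ => g, by simp⟩))
      · have h := ((Claim.holds_iff (φ := and φ ψ)).1 hh).2 rfl
        exact (not_and_or.1 h).imp (fun g => hX _ h₁ (Claim.holds_iff.2 ⟨by simp, fun _ => g⟩))
          (fun g => hX _ h₂ (Claim.holds_iff.2 ⟨by simp, fun _ => g⟩))
      · have h := sat_untl_iff.1 (((Claim.holds_iff (φ := untl φ ψ)).1 hh).1 rfl)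
        exact h.imp (fun g => hX _ h₂ (Claim.holds_iff.2 ⟨fun _ => g, by simp⟩)) fun g =>
          ⟨hX _ h₁ (Claim.holds_iff.2 ⟨fun _ => g.1, by simp⟩),
            hX' _ hcCl ((Claim.holds_iff (φ := untl φ ψ)).2 ⟨fun _ => g.2, by simp⟩)⟩
      · have h := mt sat_release_iff.2 (((Claim.holds_iff (φ := release φ ψ)).1 hh).2 rfl)
        rw [not_and_or, not_or] at h
        exact h.imp (fun g => hX _ h₂ (Claim.holds_iff.2 ⟨by simp, fun _ => g⟩)) fun g =>
          ⟨hX _ h₁ (Claim.holds_iff.2 ⟨by simp, fun _ => g.1⟩),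
            hX' _ hcCl ((Claim.holds_iff (φ := release φ ψ)).2 ⟨by simp, fun _ => g.2⟩)⟩
      · have h := sat_release_iff.1 (((Claim.holds_iff (φ := release φ ψ)).1 hh).1 rfl)
        exact ⟨hX _ h₂ (Claim.holds_iff.2 ⟨fun _ => h.1, by simp⟩), h.2.imp
          (fun g => hX _ h₁ (Claim.holds_iff.2 ⟨fun _ => g, by simp⟩))
          (fun g => hX' _ hcCl ((Claim.holds_iff (φ := release φ ψ)).2 ⟨fun _ => g, by simp⟩))⟩
      · have h := mt sat_untl_iff.2 (((Claim.holds_iff (φ := untl φ ψ)).1 hh).2 rfl)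
        rw [not_or, not_and_or] at h
        exact ⟨hX _ h₂ (Claim.holds_iff.2 ⟨by simp, fun _ => h.1⟩), h.2.imp
          (fun g => hX _ h₁ (Claim.holds_iff.2 ⟨by simp, fun _ => g⟩))
          (fun g => hX' _ hcCl ((Claim.holds_iff (φ := untl φ ψ)).2 ⟨by simp, fun _ => g⟩))⟩
  · rintro c hc ⟨s₁, t₁⟩ h₁ hs rfl
    obtain rfl : s₁ = false := hs
    obtain ⟨φ, hφ⟩ := hCl.exists_text h₁
    obtain rfl : t₁ = φ.text := hφ
    refine ⟨hX _ h₁ ?_, fun h => hD h _ hc⟩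
    obtain ⟨-, -, j, hj, hj', h⟩ := mem_keptAt.1 hc
    exact h.of_not_prompt hj' (by omega)

theorem tableau_claimsAt (hCl : SubClosed Cl) {W : ℕ → List σ} (hw : w = fun n => {a | a ∈ W n})
    (hba : b ≤ a) (hai : a ≤ i) (hi : i ≤ b + l) :
    Tableau Cl false (W i) (claimsAt Cl w k l i a) (keptAt Cl w k l i b)
      (claimsAt Cl w k l (i + 1) a) (keptAt Cl w k l (i + 1) b) := by
  refine tableau_of_holds hCl hw hba hi (fun c hc h => mem_claimsAt.2 ⟨hc, Or.inl h⟩)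
    (fun c hc h => Or.inl ?_) fun _ c hc => ?_
  · obtain ⟨h₁, h₂ | ⟨-, j, hj, hj', h₃⟩⟩ := mem_claimsAt.1 hc
    · exact mem_claimsAt.2 ⟨h₁, Or.inr ⟨h, i, hai, by omega, h₂⟩⟩
    · exact mem_claimsAt.2 ⟨h₁, Or.inr ⟨h, j, hj, by omega, h₃⟩⟩
  · obtain ⟨h₁, h₂, j, hj, hj', h₃⟩ := mem_keptAt.1 hc
    exact mem_keptAt.2 ⟨h₁, h₂, j, hj, by omega, h₃⟩

theorem tableau_claimsAt_mark (hCl : SubClosed Cl) {W : ℕ → List σ}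
    (hw : w = fun n => {a | a ∈ W n}) (hba : b ≤ a) (hai : a ≤ i) (hi : i ≤ b + l) :
    Tableau Cl true (W i) (claimsAt Cl w k l i a) (keptAt Cl w k l i b)
      (claimsAt Cl w k l (i + 1) (i + 1)) (keptAt Cl w k l (i + 1) a) := by
  refine tableau_of_holds hCl hw hba hi (fun c hc h => mem_claimsAt.2 ⟨hc, Or.inl h⟩)
    (fun c hc h => Or.inr ⟨rfl, ?_⟩) (by simp)
  obtain ⟨h₁, h₂ | ⟨-, j, hj, hj', h₃⟩⟩ := mem_claimsAt.1 hc
  · exact mem_keptAt.2 ⟨h₁, h, i, by omega, by omega, h₂⟩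
  · exact mem_keptAt.2 ⟨h₁, h, j, by omega, by omega, h₃⟩

/-- A positive prompt claim true at `i` has a witness within `k` steps; if it is not true, it is
absent at `i`. Neither case depends on the mark `a`. -/
theorem promptHit_claimsAt {c : Claim σ} (i : ℕ) :
    ∃ j ≤ k, ∀ a, PromptHit Cl c (claimsAt Cl w k l (i + j) a) := by
  by_cases hp : ∃ φ : PromptLTL σ, c = (true, Sum.inr 5 :: φ.text) ∧ c.Holds w k l i
  · obtain ⟨φ, rfl, h⟩ := hp
    obtain ⟨j, hj, hj'⟩ := ((Claim.holds_iff (φ := prompt φ)).1 h).1 rfl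
    refine ⟨j, hj, fun a c₁ h₁ hs he => Or.inr (mem_claimsAt.2 ⟨h₁, Or.inl ?_⟩)⟩
    obtain ⟨s₁, t₁⟩ := c₁
    obtain rfl : s₁ = true := hs
    simp only [Prod.mk.injEq, List.cons.injEq, true_and] at he
    rw [← he]
    exact Claim.holds_iff.2 ⟨fun _ => hj', by simp⟩
  · refine ⟨0, Nat.zero_le _, fun a c₁ h₁ hs he => Or.inl fun h => hp ?_⟩
    have hh := holds_of_mem_claimsAt h (by subst he; rintro ⟨t, ht⟩; simp at ht)
    obtain ⟨φ, hφ, -⟩ := id hh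
    cases φ <;> simp only [he, text, List.cons.injEq, reduceCtorEq, false_and, Sum.inr.injEq] at hφ
    case prompt φ => exact ⟨φ, by rw [he, hφ.2], hh⟩
    all_goals exact absurd hφ.1 (by decide)

theorem hit_claimsAt (hCl : SubClosed Cl) {c : Claim σ} (i : ℕ) :
    ∃ j, ∀ a, Hit Cl c (claimsAt Cl w k l (i + j) a) := by
  by_cases hu : ∃ φ ψ : PromptLTL σ, c.Is 3 4 (φ.text ++ ψ.text) ∧ c.Holds w k l i
  · obtain ⟨φ, ψ, he, h⟩ := hu
    have : ∃ j, Claim.Holds w k l (c.1, ψ.text) (i + j) := by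
      rcases he with rfl | rfl
      · obtain ⟨j, hj, -⟩ := ((Claim.holds_iff (φ := untl φ ψ)).1 h).1 rfl
        exact ⟨j, Claim.holds_iff.2 ⟨fun _ => hj, by simp⟩⟩
      · have := ((Claim.holds_iff (φ := release φ ψ)).1 h).2 rfl
        simp only [Sat, not_forall, not_or] at this
        obtain ⟨j, hj, -⟩ := this
        exact ⟨j, Claim.holds_iff.2 ⟨by simp, fun _ => hj⟩⟩
    obtain ⟨j, hj⟩ := this
    refine ⟨j, fun a => ⟨fun c₁ _ _ he' => ?_, fun c₁ h₁ c₂ h₂ s₁ s₂ he' =>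
      Or.inr (mem_claimsAt.2 ⟨h₂, Or.inl ?_⟩)⟩⟩
    · rcases he with rfl | rfl <;> simp at he'
    · obtain ⟨φ', hφ'⟩ := hCl.exists_text h₁
      obtain ⟨ψ', hψ'⟩ := hCl.exists_text h₂
      have ht : φ.text ++ ψ.text = φ'.text ++ ψ'.text := by
        rw [hφ', hψ'] at he'
        rcases he with rfl | rfl <;> rcases he' with he' | he' <;>
          simp only [Prod.mk.injEq, List.cons.injEq, true_and, reduceCtorEq, false_and] at he' <;>
          exact he'
      obtain ⟨-, ht⟩ := text_append_inj _ _ _ _ ht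
      rwa [show c₂ = (c.1, ψ.text) from Prod.ext s₂ (by rw [hψ', ht])]
  · obtain ⟨j, -, hj⟩ := promptHit_claimsAt (w := w) (k := k) (l := l) (Cl := Cl) (c := c) i
    -- A claim has one outermost operator, so only one part of `Hit` can be nonvacuous for `c`.
    by_cases hc : ∃ t, c.Is 3 4 t
    · refine ⟨0, fun a => ⟨fun c₁ _ _ he' => ?_, fun c₁ h₁ c₂ h₂ s₁ s₂ he => Or.inl fun h => hu ?_⟩⟩
      · obtain ⟨t, rfl | rfl⟩ := hc <;> simp at he'
      · have hh := holds_of_mem_claimsAt h (by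
          rcases he with rfl | rfl <;> rintro ⟨t, ht⟩ <;> simp at ht)
        obtain ⟨φ', hφ'⟩ := hCl.exists_text h₁
        obtain ⟨ψ', hψ'⟩ := hCl.exists_text h₂
        rw [hφ', hψ'] at he
        exact ⟨_, _, he, hh⟩
    · exact ⟨j, fun a => ⟨hj a, fun c₁ _ c₂ _ _ _ he => absurd ⟨_, he⟩ hc⟩⟩

end Completeness

end PromptLTL

/-! ### Finite tables for the systems of an asynchronous architecture -/

namespace Architecture

variable {P AP : Type*}

section Lists

/-- A list of all processes. -/
noncomputable def procs (P : Type*) [Finite P] : List P :=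
  (@Finset.univ P (Fintype.ofFinite P)).toList

theorem mem_procs [Finite P] (p : P) : p ∈ procs P := by simp [procs]

open Classical in
/-- The index of a process in `procs P`. -/
noncomputable def procIdx [Finite P] (p : P) : ℕ := (procs P).idxOf p

theorem getD_map_procs [Finite P] {α : Type*} (f : P → α) (d : α) (p : P) :
    ((procs P).map f).getD (procIdx p) d = f p := by
  classical
  have h : (procs P).idxOf p < (procs P).length := List.idxOf_lt_length_of_mem (mem_procs p)
  have h' : procIdx p < (procs P).length := by unfold procIdx; convert h
  rw [List.getD_eq_getElem _ _ (by simpa using h')]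
  simp only [List.getElem_map]
  congr 1
  unfold procIdx
  exact List.getElem_idxOf _

variable (A : Architecture P AP)

/-- `I*_p` as a list. -/
noncomputable def inputList (p : P) : List (Signal P AP) :=
  Signal.sched p :: (A.inputs p).toList.map Sum.inl

/-- `O*_p` as a list. -/
noncomputable def outputList (p : P) : List (Signal P AP) := (A.outputs p).toList.map Sum.inl

/-- `O*_env` as a list. -/
noncomputable def envList [Finite P] : List (Signal P AP) :=
  A.envOutputs.toList.map Sum.inl ++ (procs P).map Signal.sched

theorem mem_inputList {p : P} {a : Signal P AP} : a ∈ A.inputList p ↔ a ∈ A.asyncInputs p := by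
  simp [inputList, asyncInputs]

theorem mem_outputList {p : P} {a : Signal P AP} :
    a ∈ A.outputList p ↔ a ∈ A.asyncOutputs p := by
  simp [outputList, asyncOutputs]

theorem mem_envList [Finite P] {a : Signal P AP} : a ∈ A.envList ↔ a ∈ A.asyncEnvOutputs := by
  simp [envList, asyncEnvOutputs, mem_procs]

instance (p : P) : Finite (A.asyncInputs p) := by
  refine Set.Finite.to_subtype ((A.inputList p).finite_toSet.subset fun a ha => ?_)
  exact A.mem_inputList.2 ha

end Lists

open Classical in
/-- The members of `l` that lie in `s`. -/
noncomputable def restrict {σ : Type*} (l : List σ) (s : Set σ) : List σ :=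
  l.filter (· ∈ s)

theorem mem_restrict {σ : Type*} {l : List σ} {s : Set σ} {a : σ} :
    a ∈ restrict l s ↔ a ∈ l ∧ a ∈ s := by simp [restrict]

/-- Tables for the initial states, the transitions and the labels of all processes. -/
abbrev Tables (P AP : Type*) := List ℕ × List ℕ × List (List (Signal P AP))

section Tables

variable [Primcodable P] [Primcodable AP]

/-- The initial state of process `p`. -/
def initState (y : Tables P AP) (p : P) : ℕ := y.1.getD (Encodable.encode p) 0

open Classical in
/-- The state of process `p` after it has read the input `u` in state `s`. -/
noncomputable def stepState (y : Tables P AP) (p : P) (s : ℕ) (u : List (Signal P AP)) : ℕ :=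
  if Signal.sched p ∈ u then y.2.1.getD (Encodable.encode (p, s, u)) 0 else s

variable (A : Architecture P AP)

/-- The label of the state `s` of process `p`. -/
noncomputable def labelState (y : Tables P AP) (p : P) (s : ℕ) : List (Signal P AP) :=
  restrict (A.outputList p) {a | a ∈ y.2.2.getD (Encodable.encode (p, s)) []}

variable [Finite P]

/-- The letter produced in the global state `g` when the environment chooses `e`. -/
noncomputable def letter (y : Tables P AP) (g : List ℕ) (e : List (Signal P AP)) :
    List (Signal P AP) :=
  e ++ (procs P).flatMap fun p => A.labelState y p (g.getD (procIdx p) 0)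

/-- The initial global state. -/
noncomputable def initGlobal (y : Tables P AP) : List ℕ := (procs P).map (initState y)

/-- The global state after `g` when the environment chooses `e`. -/
noncomputable def stepGlobal (y : Tables P AP) (g : List ℕ) (e : List (Signal P AP)) : List ℕ :=
  (procs P).map fun p => stepState y p (g.getD (procIdx p) 0)
    (restrict (A.inputList p) {a | a ∈ A.letter y g e})

/-- The global state after `n` steps. -/
noncomputable def globalAt (y : Tables P AP) (e : ℕ → List (Signal P AP)) : ℕ → List ℕ
  | 0 => initGlobal y
  | n + 1 => A.stepGlobal y (globalAt y e n) (e n)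

/-- The choices of the environment. -/
noncomputable def envLetters : List (List (Signal P AP)) := A.envList.sublists'

end Tables

section Product

variable (A : Architecture P AP) {f : ∀ p, Strategy (A.asyncInputs p) (A.asyncOutputs p)}
  {S : P → Type*} {T : ∀ p, TransitionSystem (A.asyncInputs p) (A.asyncOutputs p) (S p)}

/-- The states of the processes after the environment has produced `u`. -/
def localStates (f : ∀ p, Strategy (A.asyncInputs p) (A.asyncOutputs p))
    (T : ∀ p, TransitionSystem (A.asyncInputs p) (A.asyncOutputs p) (S p))
    (u : List (Set A.asyncEnvOutputs)) (p : P) : S p :=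
  (T p).reach (A.localInputs f u p)

theorem run_eq (hT : ∀ p, (T p).Generates (f p)) (e : ℕ → Set A.asyncEnvOutputs) (n : ℕ) :
    (A.product f).run e n =
      (⋃ p, Subtype.val '' (T p).label (A.localStates f T ((List.range n).map e) p)) ∪
        Subtype.val '' e n := by
  have h : A.jointOutput f (A.localInputs f ((List.range n).map e)) ⊆ A.allOutputs := by
    refine Set.iUnion_subset fun p => ?_
    rintro _ ⟨x, -, rfl⟩
    exact Set.mem_iUnion.2 ⟨p, x.2⟩
  unfold Strategy.run product
  rw [Subtype.image_preimage_coe, Set.inter_eq_right.2 h]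
  unfold jointOutput localStates
  simp only [fun p => hT p _]

theorem localInputs_succ (hT : ∀ p, (T p).Generates (f p)) (e : ℕ → Set A.asyncEnvOutputs)
    (n : ℕ) (p : P) : A.localInputs f ((List.range (n + 1)).map e) p =
      A.localInputs f ((List.range n).map e) p ++ [Subtype.val ⁻¹' (A.product f).run e n] := by
  have h : A.jointOutput f (A.localInputs f ((List.range n).map e)) =
      ⋃ p, Subtype.val '' (T p).label (A.localStates f T ((List.range n).map e) p) := by
    unfold jointOutput localStates
    simp only [fun p => hT p _]
  rw [A.run_eq hT, ← h, List.range_succ, List.map_append]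
  simp [localInputs]

end Product

section Simulation

variable [Primcodable P] [Primcodable AP] (A : Architecture P AP)
  {f : ∀ p, Strategy (A.asyncInputs p) (A.asyncOutputs p)}

/-- The tables `y` describe the reachable part of `T`, with states numbered by `v`. -/
structure Describes (y : Tables P AP) (p : P) {S : Type*}
    (T : TransitionSystem (A.asyncInputs p) (A.asyncOutputs p) S) (v : S → ℕ) : Prop where
  init : v T.init = initState y p
  label : ∀ s, Subtype.val '' T.label s = {a | a ∈ A.labelState y p (v s)}
  step : ∀ u a, v (T.reach (u ++ [a])) =
    stepState y p (v (T.reach u)) (restrict (A.inputList p) (Subtype.val '' a))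

variable [Finite P]

theorem run_eq_letter {S : P → Type*}
    {T : ∀ p, TransitionSystem (A.asyncInputs p) (A.asyncOutputs p) (S p)}
    (hT : ∀ p, (T p).Generates (f p)) {y : Tables P AP} {v : ∀ p, S p → ℕ}
    (hv : ∀ p, A.Describes y p (T p) (v p)) {e : ℕ → Set A.asyncEnvOutputs}
    {e' : ℕ → List (Signal P AP)} (he : ∀ n, Subtype.val '' e n = {a | a ∈ e' n}) (n : ℕ) :
    (A.product f).run e n = {a | a ∈ A.letter y (A.globalAt y e' n) (e' n)} := by
  -- Equal states give equal letters at the same time; the induction on states uses this in its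
  -- step.
  have key : ∀ n, A.globalAt y e' n =
        (procs P).map (fun p => v p (A.localStates f T ((List.range n).map e) p)) →
      (A.product f).run e n = {a | a ∈ A.letter y (A.globalAt y e' n) (e' n)} := by
    intro n hn
    rw [A.run_eq hT, hn]
    ext a
    simp only [he, letter, Set.mem_union, Set.mem_iUnion, (hv _).label, Set.mem_ofPred_eq,
      List.mem_append, List.mem_flatMap, mem_procs, true_and, getD_map_procs]
    exact or_comm
  refine key n ?_
  induction n with
  | zero =>
    refine List.map_congr_left fun p _ => ?_
    simpa [localStates, localInputs, TransitionSystem.reach] using (hv p).init.symm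
  | succ n ih =>
    rw [globalAt, stepGlobal]
    refine List.map_congr_left fun p _ => ?_
    rw [localStates, A.localInputs_succ hT, (hv p).step, key n ih, ih, getD_map_procs, localStates]
    congr 1
    unfold restrict
    refine List.filter_congr fun a ha => ?_
    simp [A.mem_inputList.1 ha]

end Simulation

end Architecture

theorem List.exists_getD_eq {ι α : Type*} [Finite ι] {code : ι → ℕ}
    (hc : Function.Injective code) (g : ι → α) (d : α) :
    ∃ L : List α, ∀ x, L.getD (code x) d = g x := by
  obtain ⟨N, hN⟩ := (Set.finite_range code).bddAbove
  refine ⟨(List.range (N + 1)).map (Function.extend code g fun _ => d), fun x => ?_⟩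
  have : code x < N + 1 := Nat.lt_succ_of_le (hN ⟨x, rfl⟩)
  rw [List.getD_eq_getElem _ _ (by simpa using this)]
  simp [hc.extend_apply]

theorem List.getD_zero_le_sum (L : List ℕ) (i : ℕ) : L.getD i 0 ≤ L.sum := by
  rcases lt_or_ge i L.length with h | h
  · rw [List.getD_eq_getElem _ _ h]
    exact List.le_sum_of_mem (List.getElem_mem h)
  · rw [List.getD_eq_default _ _ h]
    exact Nat.zero_le _

theorem List.finite_length_eq_and_le (n B : ℕ) :
    {g : List ℕ | g.length = n ∧ ∀ x ∈ g, x ≤ B}.Finite := by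
  refine ((List.finite_length_eq (Fin (B + 1)) n).image (List.map Fin.val)).subset ?_
  rintro g ⟨hg, hB⟩
  refine ⟨g.attach.map fun x => ⟨x.1, Nat.lt_succ_of_le (hB _ x.2)⟩, by simpa using hg, ?_⟩
  simp

namespace Architecture

variable {P AP : Type*} [Primcodable P] [Primcodable AP]

/-- A bound on the entries of the tables. -/
def Tables.bound (y : Tables P AP) : ℕ := y.1.sum + y.2.1.sum

theorem initState_le (y : Tables P AP) (p : P) : initState y p ≤ Tables.bound y :=
  (List.getD_zero_le_sum _ _).trans (Nat.le_add_right _ _)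

theorem stepState_le (y : Tables P AP) (p : P) {s : ℕ} (hs : s ≤ Tables.bound y)
    (u : List (Signal P AP)) : stepState y p s u ≤ Tables.bound y := by
  unfold stepState
  split_ifs
  · exact (List.getD_zero_le_sum _ _).trans (Nat.le_add_left _ _)
  · exact hs

variable (A : Architecture P AP)

/-- The system of process `p` given by the tables `y`. -/
noncomputable def system (y : Tables P AP) (p : P) :
    TransitionSystem (A.asyncInputs p) (A.asyncOutputs p) (Fin (Tables.bound y + 1)) where
  init := ⟨initState y p, Nat.lt_succ_of_le (initState_le y p)⟩
  step s a := ⟨stepState y p s (restrict (A.inputList p) (Subtype.val '' a)),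
    Nat.lt_succ_of_le (stepState_le y p (Nat.le_of_lt_succ s.2) _)⟩
  label s := Subtype.val ⁻¹' {a | a ∈ A.labelState y p s}

theorem describes_system (y : Tables P AP) (p : P) :
    A.Describes y p (A.system y p) Fin.val where
  init := rfl
  label s := by
    refine (Subtype.image_preimage_coe _ _).trans (Set.inter_eq_right.2 fun a ha => ?_)
    exact A.mem_outputList.1 (mem_restrict.1 ha).1
  step u a := by
    simp only [TransitionSystem.reach, List.foldl_append, List.foldl_cons, List.foldl_nil]
    rfl

/-- Arbitrary tables are admissible: missing entries take default values, `labelState` keeps only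
outputs of `p`, and `stepState` ignores inputs without `sched p`. Hence a search over tables needs
no validity check. -/
theorem exists_strategy (y : Tables P AP) (p : P) :
    ∃ f : Strategy (A.asyncInputs p) (A.asyncOutputs p),
      A.IsAsyncFiniteState p f ∧ (A.system y p).Generates f := by
  refine ⟨fun u => (A.system y p).label ((A.system y p).reach u),
    ⟨_, A.system y p, fun _ => rfl, fun u a ha => Fin.ext ?_⟩, fun _ => rfl⟩
  rw [(A.describes_system y p).step, stepState, if_neg fun h => ha (mem_restrict.1 h).2]

theorem restrict_inputList_injective (p : P) : Function.Injective
    fun a : Set (A.asyncInputs p) => restrict (A.inputList p) (Subtype.val '' a) := by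
  intro a b h
  refine Set.ext fun x => ?_
  have : (x : Signal P AP) ∈ restrict (A.inputList p) (Subtype.val '' a) ↔
      (x : Signal P AP) ∈ restrict (A.inputList p) (Subtype.val '' b) := by
    beta_reduce at h
    rw [h]
  simpa [mem_restrict, A.mem_inputList] using this

theorem exists_tables [Finite P] {n : P → ℕ}
    (T : ∀ p, TransitionSystem (A.asyncInputs p) (A.asyncOutputs p) (Fin (n p)))
    (hT : ∀ p (u : List (Set (A.asyncInputs p))) (a : Set (A.asyncInputs p)),
      Signal.sched p ∉ Subtype.val '' a → (T p).reach (u ++ [a]) = (T p).reach u) :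
    ∃ y : Tables P AP, ∀ p, A.Describes y p (T p) Fin.val := by
  obtain ⟨L₁, h₁⟩ := List.exists_getD_eq (Encodable.encode_injective (α := P))
    (fun p => ((T p).init : ℕ)) 0
  obtain ⟨L₂, h₂⟩ := List.exists_getD_eq (ι := Σ p, Fin (n p) × Set (A.asyncInputs p))
    (code := fun x => Encodable.encode
      (x.1, (x.2.1 : ℕ), restrict (A.inputList x.1) (Subtype.val '' x.2.2)))
    (by
      rintro ⟨p, s, a⟩ ⟨p', s', a'⟩ h
      have h := Encodable.encode_injective h
      simp only [Prod.mk.injEq] at h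
      obtain ⟨rfl, h', h''⟩ := h
      obtain rfl := Fin.ext h'
      obtain rfl := A.restrict_inputList_injective p h''
      rfl)
    (fun x => (((T x.1).step x.2.1 x.2.2 : Fin (n x.1)) : ℕ)) 0
  obtain ⟨L₃, h₃⟩ := List.exists_getD_eq (ι := Σ p, Fin (n p))
    (code := fun x => Encodable.encode (x.1, (x.2 : ℕ)))
    (by
      rintro ⟨p, s⟩ ⟨p', s'⟩ h
      have h := Encodable.encode_injective h
      simp only [Prod.mk.injEq] at h
      obtain ⟨rfl, h'⟩ := h
      obtain rfl := Fin.ext h'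
      rfl)
    (fun x => restrict (A.outputList x.1) (Subtype.val '' (T x.1).label x.2)) []
  refine ⟨(L₁, L₂, L₃), fun p => ⟨(h₁ p).symm, fun s => ?_, fun u a => ?_⟩⟩
  · ext a
    have := h₃ ⟨p, s⟩
    simp only at this
    simp only [labelState, mem_restrict, Set.mem_ofPred_eq, this, A.mem_outputList]
    constructor
    · rintro ⟨x, hx, rfl⟩
      exact ⟨x.2, x.2, x, hx, rfl⟩
    · exact fun h => h.2.2
  · by_cases ha : Signal.sched p ∈ Subtype.val '' a
    · have hmem : Signal.sched p ∈ restrict (A.inputList p) (Subtype.val '' a) :=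
        mem_restrict.2 ⟨by simp [inputList], ha⟩
      rw [stepState, if_pos hmem]
      refine Eq.trans ?_ (h₂ ⟨p, (T p).reach u, a⟩).symm
      simp [TransitionSystem.reach]
    -- Only reached states are known to stutter, which is why `Describes.step` speaks of `T.reach
    -- u`.
    · rw [stepState, if_neg fun h => ha (mem_restrict.1 h).2, hT p u a ha]

variable [Finite P]

/-- Realizability in terms of tables. -/
theorem asyncRealizable_iff (φ ψ : PromptLTL (Signal P AP)) :
    A.AsyncRealizable φ ψ ↔ ∃ y : Tables P AP, ∀ k, ∃ l, ∀ e : ℕ → List (Signal P AP),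
      (∀ n, e n ∈ A.envLetters) →
      φ.Models (fun n => {a | a ∈ A.letter y (A.globalAt y e n) (e n)}) k →
      ψ.Models (fun n => {a | a ∈ A.letter y (A.globalAt y e n) (e n)}) l := by
  constructor
  · rintro ⟨f, hf, h⟩
    choose n T hg hT using hf
    obtain ⟨y, hy⟩ := A.exists_tables T hT
    refine ⟨y, fun k => (h k).imp fun l hl e he => ?_⟩
    have hw := A.run_eq_letter hg hy (e := fun n => Subtype.val ⁻¹' {a | a ∈ e n}) (e' := e)
      fun n => by
        refine (Subtype.image_preimage_coe _ _).trans (Set.inter_eq_right.2 fun a ha => ?_)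
        exact A.mem_envList.1 ((List.mem_sublists'.1 (he n)).subset ha)
    rw [← funext hw]
    exact hl _ ⟨_, rfl⟩
  · rintro ⟨y, h⟩
    choose f hf hg using A.exists_strategy y
    refine ⟨f, hf, fun k => (h k).imp fun l hl => ?_⟩
    rintro _ ⟨e, rfl⟩
    have hw := A.run_eq_letter hg (A.describes_system y) (e := e)
      (e' := fun n => restrict A.envList (Subtype.val '' e n)) fun n => by
        ext a
        simp only [Set.mem_ofPred_eq, mem_restrict, A.mem_envList]
        constructor
        · rintro ⟨x, hx, rfl⟩
          exact ⟨x.2, x, hx, rfl⟩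
        · exact fun h => h.2
    rw [funext hw]
    exact hl _ fun n => List.mem_sublists'.2 List.filter_sublist

/-- The global states with entries that occur in the tables. -/
theorem exists_global_list (y : Tables P AP) : ∃ G : List (List ℕ), initGlobal y ∈ G ∧
    ∀ g ∈ G, ∀ e, A.stepGlobal y g e ∈ G := by
  -- Table entries, and the default `0`, are bounded by the sums of the tables, so global states
  -- stay in a finite box.
  have hfin := List.finite_length_eq_and_le (procs P).length (Tables.bound y)
  refine ⟨hfin.toFinset.toList, ?_, fun g hg e => ?_⟩
  · simpa [initGlobal] using fun p _ => initState_le y p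
  · simp only [Finset.mem_toList, Set.Finite.mem_toFinset, Set.mem_ofPred_eq] at hg ⊢
    refine ⟨by simp [stepGlobal], fun x hx => ?_⟩
    obtain ⟨p, -, rfl⟩ := List.mem_map.1 hx
    refine stepState_le y p ?_ _
    rcases lt_or_ge (procIdx p) g.length with h | h
    · rw [List.getD_eq_getElem _ _ h]
      exact hg.2 _ (List.getElem_mem h)
    · rw [List.getD_eq_default _ _ h]
      exact Nat.zero_le _

end Architecture

/-! ### Certificates for realizability -/

namespace CycleCover

variable {V κ : Type*} {Q Q' : V → V → Prop} {H : κ → V → Prop} {Cl : List κ} {U : List V}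
  {R : List (V × V)}

/-- `Q` restricted to `U`. -/
def On (U : List V) (Q : V → V → Prop) (u v : V) : Prop := u ∈ U ∧ v ∈ U ∧ Q u v

/-- `R` contains `Q` on `U` and is closed under composition with it. -/
def ClosedRel (U : List V) (R : List (V × V)) (Q : V → V → Prop) : Prop :=
  (∀ u ∈ U, ∀ v ∈ U, Q u v → (u, v) ∈ R) ∧ ∀ x ∈ R, ∀ v ∈ U, Q x.2 v → (x.1, v) ∈ R

/-- `Covers` for a relation given as a list of pairs. -/
def ListCovers (U : List V) (R : List (V × V)) (H : κ → V → Prop) (Cl : List κ) (x : V) : Prop :=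
  (x, x) ∈ R ∧ ∀ c ∈ Cl, ∃ z ∈ U, H c z ∧ (x, z) ∈ R ∧ (z, x) ∈ R

/-- Soundness of certificates needs only this inclusion: a relation that is too large allows more
marks and more cycles, and so makes `NoCycle` stronger. -/
theorem ClosedRel.mem_of_transGen (h : ClosedRel U R Q) {u v : V} (huv : TransGen (On U Q) u v) :
    (u, v) ∈ R := by
  induction huv with
  | single huv => exact h.1 _ huv.1 _ huv.2.1 huv.2.2
  | tail _ huv ih => exact h.2 _ ih _ huv.2.1 huv.2.2

theorem Covers.listCovers (h : ClosedRel U R Q) {x : V} (hx : Covers (On U Q) H Cl x) :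
    ListCovers U R H Cl x := by
  refine ⟨h.mem_of_transGen hx.1, fun c hc => ?_⟩
  obtain ⟨z, hz, h₁, h₂⟩ := hx.2 c hc
  have hzU : z ∈ U := by
    obtain ⟨_, -, h⟩ := TransGen.tail'_iff.1 h₁
    exact h.2.1
  exact ⟨z, hzU, hz, h.mem_of_transGen h₁, h.mem_of_transGen h₂⟩

theorem ListCovers.covers (h : ∀ u v, (u, v) ∈ R → TransGen Q u v) {x : V}
    (hx : ListCovers U R H Cl x) : Covers Q H Cl x := by
  refine ⟨h _ _ hx.1, fun c hc => ?_⟩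
  obtain ⟨z, -, hz, h₁, h₂⟩ := hx.2 c hc
  exact ⟨z, hz, h _ _ h₁, h _ _ h₂⟩

/-- For completeness `R` must contain only genuine paths; the transitive closure of `Q` on `U` is
taken. -/
theorem exists_closedRel (h : ∀ u ∈ U, ∀ v ∈ U, Q u v → Q' u v) :
    ∃ R : List (V × V), ClosedRel U R Q ∧ ∀ u v, (u, v) ∈ R → TransGen Q' u v := by
  classical
  refine ⟨(U ×ˢ U).filter fun x => TransGen (On U Q) x.1 x.2, ⟨fun u hu v hv huv => ?_,
    fun x hx v hv huv => ?_⟩, fun u v huv => ?_⟩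
  · simpa [hu, hv] using TransGen.single (show On U Q u v from ⟨hu, hv, huv⟩)
  · simp only [List.mem_filter, decide_eq_true_eq] at hx ⊢
    obtain ⟨hx, hx'⟩ := hx
    have hx := List.mem_product.1 hx
    exact ⟨List.mem_product.2 ⟨hx.1, hv⟩, hx'.tail ⟨hx.2, hv, huv⟩⟩
  · simp only [List.mem_filter, decide_eq_true_eq] at huv
    exact TransGen.mono (fun u v huv => h _ huv.1 _ huv.2.1 huv.2.2) _ _ huv.2

end CycleCover

namespace PromptLTL

variable {σ : Type*}

theorem SubClosed.append {Cl Cl' : List (Claim σ)} (h : SubClosed Cl) (h' : SubClosed Cl') :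
    SubClosed (Cl ++ Cl') := by
  have mono : ∀ {Cl Cl' : List (Claim σ)}, SubClosed Cl → Cl ⊆ Cl' → ∀ c ∈ Cl, _ :=
    fun {Cl Cl'} h hs c hc => show (∃ x ∈ c.2, c.2 = [x] ∧ x.isLeft = true) ∨
      (∃ c₁ ∈ Cl', c₁.1 = c.1 ∧ (c.2 = Sum.inr 2 :: c₁.2 ∨ c.2 = Sum.inr 5 :: c₁.2)) ∨
      ∃ c₁ ∈ Cl', ∃ c₂ ∈ Cl', (c₁.1 = c.1 ∧ c₂.1 = c.1) ∧
        ∃ o ∈ [(0 : Fin 6), 1, 3, 4], c.2 = Sum.inr o :: (c₁.2 ++ c₂.2) from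
      (h c hc).imp_right (Or.imp (fun ⟨c₁, h₁, h⟩ => ⟨c₁, hs h₁, h⟩)
        fun ⟨c₁, h₁, c₂, h₂, h⟩ => ⟨c₁, hs h₁, c₂, hs h₂, h⟩)
  intro c hc
  rcases List.mem_append.1 hc with hc | hc
  · exact mono h (List.subset_append_left _ _) c hc
  · exact mono h' (List.subset_append_right _ _) c hc

theorem SubClosed.cons_unary {Cl : List (Claim σ)} (h : SubClosed Cl) {c₁ : Claim σ}
    (h₁ : c₁ ∈ Cl) {o : Fin 6} (ho : o = 2 ∨ o = 5) :
    SubClosed ((c₁.1, Sum.inr o :: c₁.2) :: Cl) := by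
  intro c hc
  rcases List.mem_cons.1 hc with rfl | hc
  · refine Or.inr (Or.inl ⟨c₁, by simp [h₁], rfl, ?_⟩)
    rcases ho with rfl | rfl
    · exact Or.inl rfl
    · exact Or.inr rfl
  · exact (h c hc).imp_right (Or.imp (fun ⟨c₁, h₁, h⟩ => ⟨c₁, by simp [h₁], h⟩)
      fun ⟨c₁, h₁, c₂, h₂, h⟩ => ⟨c₁, by simp [h₁], c₂, by simp [h₂], h⟩)

theorem SubClosed.cons_binary {Cl : List (Claim σ)} (h : SubClosed Cl) {s : Bool}
    {t₁ t₂ : List (Symb σ)} (h₁ : (s, t₁) ∈ Cl) (h₂ : (s, t₂) ∈ Cl) {o : Fin 6}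
    (ho : o ∈ [(0 : Fin 6), 1, 3, 4]) : SubClosed ((s, Sum.inr o :: (t₁ ++ t₂)) :: Cl) := by
  intro c hc
  rcases List.mem_cons.1 hc with rfl | hc
  · exact Or.inr (Or.inr ⟨_, List.mem_cons_of_mem _ h₁, _, List.mem_cons_of_mem _ h₂,
      ⟨rfl, rfl⟩, o, ho, rfl⟩)
  · exact (h c hc).imp_right (Or.imp (fun ⟨c₁, h₁, h⟩ => ⟨c₁, by simp [h₁], h⟩)
      fun ⟨c₁, h₁, c₂, h₂, h⟩ => ⟨c₁, by simp [h₁], c₂, by simp [h₂], h⟩)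

theorem exists_subClosed (s : Bool) (φ : PromptLTL σ) :
    ∃ Cl : List (Claim σ), SubClosed Cl ∧ (s, φ.text) ∈ Cl := by
  have bin : ∀ (φ ψ : PromptLTL σ) (o : Fin 6), o ∈ [(0 : Fin 6), 1, 3, 4] →
      (∃ Cl : List (Claim σ), SubClosed Cl ∧ (s, φ.text) ∈ Cl) →
      (∃ Cl : List (Claim σ), SubClosed Cl ∧ (s, ψ.text) ∈ Cl) →
      ∃ Cl : List (Claim σ), SubClosed Cl ∧ (s, Sum.inr o :: (φ.text ++ ψ.text)) ∈ Cl := by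
    rintro φ ψ o ho ⟨Cl, h, h₁⟩ ⟨Cl', h', h₂⟩
    exact ⟨_, (h.append h').cons_binary (List.mem_append_left _ h₁) (List.mem_append_right _ h₂) ho,
      List.mem_cons_self⟩
  induction φ with
  | lit b a =>
    refine ⟨[(s, [Sum.inl (b, a)])], fun c hc => Or.inl ?_, by simp [text]⟩
    obtain rfl := List.mem_singleton.1 hc
    exact ⟨_, List.mem_singleton_self _, rfl, rfl⟩
  | and φ ψ ih₁ ih₂ => exact bin φ ψ 0 (by simp) ih₁ ih₂
  | or φ ψ ih₁ ih₂ => exact bin φ ψ 1 (by simp) ih₁ ih₂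
  | untl φ ψ ih₁ ih₂ => exact bin φ ψ 3 (by simp) ih₁ ih₂
  | release φ ψ ih₁ ih₂ => exact bin φ ψ 4 (by simp) ih₁ ih₂
  | next φ ih =>
    obtain ⟨Cl, h, h₁⟩ := ih
    exact ⟨_, h.cons_unary h₁ (Or.inl rfl), List.mem_cons_self⟩
  | prompt φ ih =>
    obtain ⟨Cl, h, h₁⟩ := ih
    exact ⟨_, h.cons_unary h₁ (Or.inr rfl), List.mem_cons_self⟩

end PromptLTL

namespace Architecture

open PromptLTL CycleCover

/-- A global state, a choice of the environment, the claims made and the older claims kept. -/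
abbrev Node (σ : Type*) := (List ℕ × List σ) × (List (Claim σ) × List (Claim σ))

variable {P AP : Type*} [Finite P] [Primcodable P] [Primcodable AP] (A : Architecture P AP)

/-- The edges between nodes. -/
def Edge (y : Tables P AP) (Cl : List (Claim (Signal P AP))) (mark : Bool)
    (u v : Node (Signal P AP)) : Prop :=
  v.1.1 = A.stepGlobal y u.1.1 u.1.2 ∧
    Tableau Cl mark (A.letter y u.1.1 u.1.2) u.2.1 u.2.2 v.2.1 v.2.2

/-- All nodes with global states from `G` and claims from `Cl`. -/
noncomputable def nodes (G : List (List ℕ)) (Cl : List (Claim (Signal P AP))) :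
    List (Node (Signal P AP)) :=
  (G ×ˢ A.envLetters) ×ˢ (Cl.sublists' ×ˢ Cl.sublists')

/-- Edges between nodes, where a mark is allowed if the list `R` of pairs witnesses a covering
cycle. -/
def CheckedEdge (y : Tables P AP) (Cl : List (Claim (Signal P AP)))
    (U : List (Node (Signal P AP))) (R : List (Node (Signal P AP) × Node (Signal P AP)))
    (u v : Node (Signal P AP)) : Prop :=
  A.Edge y Cl false u v ∨
    (A.Edge y Cl true u v ∧ ListCovers U R (fun c u => PromptHit Cl c u.2.1) Cl u)

/-- Tables, reachable global states, claims, and two relations between nodes. -/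
abbrev Certificate (P AP : Type*) :=
  Tables P AP × List (List ℕ) × List (Claim (Signal P AP)) ×
    List (Node (Signal P AP) × Node (Signal P AP)) ×
    List (Node (Signal P AP) × Node (Signal P AP))

/-- No cycle that is reachable from an initial node covers all eventualities. -/
def NoCycle (y : Tables P AP) (Cl : List (Claim (Signal P AP))) (U : List (Node (Signal P AP)))
    (R : List (Node (Signal P AP) × Node (Signal P AP)))
    (c : List (Symb (Signal P AP)) × List (Symb (Signal P AP))) : Prop :=
  ∀ u ∈ U, u.1.1 = initGlobal y ∧ (true, c.1) ∈ u.2.1 ∧ (false, c.2) ∈ u.2.1 →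
    ∀ x ∈ U, (u, x) ∈ R → ¬ ListCovers U R (fun c u => Hit Cl c u.2.1) Cl x

/-- The certificate `z` proves that `c` is realizable. -/
def Certifies (z : Certificate P AP)
    (c : List (Symb (Signal P AP)) × List (Symb (Signal P AP))) : Prop :=
  (SubClosed z.2.2.1 ∧ (true, c.1) ∈ z.2.2.1 ∧ (false, c.2) ∈ z.2.2.1) ∧
  (initGlobal z.1 ∈ z.2.1 ∧ ∀ g ∈ z.2.1, ∀ e ∈ A.envLetters, A.stepGlobal z.1 g e ∈ z.2.1) ∧
  ClosedRel (A.nodes z.2.1 z.2.2.1) z.2.2.2.1 (A.Edge z.1 z.2.2.1 false) ∧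
  ClosedRel (A.nodes z.2.1 z.2.2.1) z.2.2.2.2
    (A.CheckedEdge z.1 z.2.2.1 (A.nodes z.2.1 z.2.2.1) z.2.2.2.1) ∧
  NoCycle z.1 z.2.2.1 (A.nodes z.2.1 z.2.2.1) z.2.2.2.2 c

theorem mem_nodes {G : List (List ℕ)} {Cl : List (Claim (Signal P AP))}
    {u : Node (Signal P AP)} : u ∈ A.nodes G Cl ↔
      (u.1.1 ∈ G ∧ u.1.2 ∈ A.envLetters) ∧ u.2.1.Sublist Cl ∧ u.2.2.Sublist Cl := by
  unfold nodes
  rw [List.mem_product, List.mem_product, List.mem_product, List.mem_sublists',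
    List.mem_sublists']

theorem Certifies.realizes {z : Certificate P AP} {φ ψ : PromptLTL (Signal P AP)}
    (hz : A.Certifies z (φ.text, ψ.text)) (k : ℕ) : ∃ l, ∀ e : ℕ → List (Signal P AP),
      (∀ n, e n ∈ A.envLetters) →
      φ.Models (fun n => {a | a ∈ A.letter z.1 (A.globalAt z.1 e n) (e n)}) k →
      ψ.Models (fun n => {a | a ∈ A.letter z.1 (A.globalAt z.1 e n) (e n)}) l := by
  obtain ⟨y, G, Cl, R₁, R₂⟩ := z
  obtain ⟨⟨hCl, hφ, hψ⟩, ⟨hG, hG'⟩, hR₁, hR₂, hno⟩ := hz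
  simp only at hCl hφ hψ hG hG' hR₁ hR₂ hno ⊢
  set U := A.nodes G Cl with hU
  have hfin : {u | u ∈ U}.Finite := U.finite_toSet
  -- The threshold of `exists_covers_markedStep`: two waiting times for a mark and one extra step.
  refine ⟨2 * ({u | u ∈ U}.ncard * (k + 1)) + 1, fun e he hm => ?_⟩
  set l := 2 * ({u | u ∈ U}.ncard * (k + 1)) + 1
  by_contra hm'
  let W := fun n => A.letter y (A.globalAt y e n) (e n)
  let w : ℕ → Set (Signal P AP) := fun n => {a | a ∈ W n}
  let S : ℕ → ℕ → ℕ → Node (Signal P AP) := fun i a b =>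
    ((A.globalAt y e i, e i), (claimsAt Cl w k l i a, keptAt Cl w k l i b))
  have hg : ∀ n, A.globalAt y e n ∈ G := fun n => by
    induction n with
    | zero => exact hG
    | succ n ih => exact hG' _ ih _ (he n)
  have hS : ∀ i a b, S i a b ∈ U := fun i a b =>
    A.mem_nodes.2 ⟨⟨hg i, he i⟩, List.filter_sublist, List.filter_sublist⟩
  obtain ⟨x, hxU, hx, hx'⟩ := exists_covers_markedStep (Cl := Cl) (E := On U (A.Edge y Cl false))
    (M := On U (A.Edge y Cl true)) (B := fun c u => PromptHit Cl c u.2.1)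
    (H := fun c u => Hit Cl c u.2.1) hfin (S := S) (k := k) (l := l) hS le_rfl
    (fun i a b h₁ h₂ h₃ => ⟨hS _ _ _, hS _ _ _, rfl, tableau_claimsAt hCl rfl h₁ h₂ h₃⟩)
    (fun i a b h₁ h₂ h₃ => ⟨hS _ _ _, hS _ _ _, rfl, tableau_claimsAt_mark hCl rfl h₁ h₂ h₃⟩)
    (fun c _ i => (promptHit_claimsAt i).imp fun j hj => ⟨hj.1, fun a _ => hj.2 a⟩)
    (fun c _ i => (hit_claimsAt hCl i).imp fun j hj a _ => hj a)
  have hstep : ∀ u v, MarkedStep (On U (A.Edge y Cl false)) (On U (A.Edge y Cl true))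
      (fun c u => PromptHit Cl c u.2.1) Cl u v → On U (A.CheckedEdge y Cl U R₁) u v := by
    rintro u v (h | ⟨h, h'⟩)
    · exact ⟨h.1, h.2.1, Or.inl h.2.2⟩
    · exact ⟨h.1, h.2.1, Or.inr ⟨h.2.2, h'.listCovers hR₁⟩⟩
  have hmem : ∀ {c : Claim (Signal P AP)}, c ∈ Cl → c.Holds w k l 0 → c ∈ claimsAt Cl w k l 0 0 :=
    fun hc h => mem_claimsAt.2 ⟨hc, Or.inl h⟩
  refine hno (S 0 0 0) (hS _ _ _) ⟨rfl, hmem hφ (Claim.holds_iff.2 ⟨fun _ => hm, by simp⟩),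
    hmem hψ (Claim.holds_iff.2 ⟨by simp, fun _ => hm'⟩)⟩ x hxU
    (hR₂.mem_of_transGen (TransGen.mono hstep _ _ hx)) (Covers.listCovers hR₂ ⟨TransGen.mono hstep _ _ hx'.1, fun c hc => ?_⟩)
  obtain ⟨z, hz, h₁, h₂⟩ := hx'.2 c hc
  exact ⟨z, hz, TransGen.mono hstep _ _ h₁, TransGen.mono hstep _ _ h₂⟩

theorem exists_certificate {y : Tables P AP} {φ ψ : PromptLTL (Signal P AP)}
    (h : ∀ k, ∃ l, ∀ e : ℕ → List (Signal P AP), (∀ n, e n ∈ A.envLetters) →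
      φ.Models (fun n => {a | a ∈ A.letter y (A.globalAt y e n) (e n)}) k →
      ψ.Models (fun n => {a | a ∈ A.letter y (A.globalAt y e n) (e n)}) l) :
    ∃ z : Certificate P AP, A.Certifies z (φ.text, ψ.text) := by
  obtain ⟨G, hG, hG'⟩ := A.exists_global_list y
  obtain ⟨Cl₁, hCl₁, hφ⟩ := exists_subClosed true φ
  obtain ⟨Cl₂, hCl₂, hψ⟩ := exists_subClosed false ψ
  have hCl := hCl₁.append hCl₂
  replace hφ := List.mem_append_left Cl₂ hφ
  replace hψ := List.mem_append_right Cl₁ hψ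
  generalize Cl₁ ++ Cl₂ = Cl at hCl hφ hψ
  set U := A.nodes G Cl with hU
  obtain ⟨R₁, hR₁, hR₁'⟩ := exists_closedRel (U := U) (Q := A.Edge y Cl false)
    (Q' := On U (A.Edge y Cl false)) fun u hu v hv h => ⟨hu, hv, h⟩
  obtain ⟨R₂, hR₂, hR₂'⟩ := exists_closedRel (U := U) (Q := A.CheckedEdge y Cl U R₁)
    (Q' := MarkedStep (On U (A.Edge y Cl false)) (On U (A.Edge y Cl true))
      (fun c u => PromptHit Cl c u.2.1) Cl) (by
    rintro u hu v hv (h | ⟨h, h'⟩)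
    · exact Or.inl ⟨hu, hv, h⟩
    · exact Or.inr ⟨⟨hu, hv, h⟩, h'.covers hR₁'⟩)
  refine ⟨(y, G, Cl, R₁, R₂), ⟨hCl, hφ, hψ⟩, ⟨hG, fun g hg e _ => hG' g hg e⟩, hR₁, hR₂, ?_⟩
  rintro u hu ⟨hu₁, hu₂, hu₃⟩ x hx hux hcyc
  -- The cycle alone determines `k`; then `l` is what the strategies guarantee for this `k`, and the
  -- path is pumped beyond that `l`.
  obtain ⟨k, hk⟩ := exists_long_blocks (fun c v hcv => hcv.1) (hR₂' _ _ hux)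
    (hcyc.covers hR₂')
  obtain ⟨l, hl⟩ := h k
  obtain ⟨p, b, hp0, hE, hM, hb, hP, hH⟩ := hk l
  have hM' : ∀ i, On U (A.Edge y Cl true) (p i) (p (i + 1)) := fun i => by
    by_cases hi : b i
    · exact hM i hi
    · obtain ⟨h₁, h₂, h₃, h₄⟩ := hE i hi
      exact ⟨h₁, h₂, h₃, h₄.weaken⟩
  have hglob : ∀ n, (p n).1.1 = A.globalAt y (fun n => (p n).1.2) n := fun n => by
    induction n with
    | zero => rw [hp0, hu₁]; rfl
    | succ n ih => rw [(hM' n).2.2.1, ih]; rfl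
  have hW : ∀ n, A.letter y (p n).1.1 (p n).1.2 =
      A.letter y (A.globalAt y (fun n => (p n).1.2) n) (p n).1.2 := fun n => by rw [hglob]
  have key := holds_of_tableau hCl (W := fun n => A.letter y (p n).1.1 (p n).1.2)
    (X := fun n => (p n).2.1) (D := fun n => (p n).2.2) (b := b) (k := k) (l := l)
    (fun i => (hM' i).2.2.2) (fun i hi => (hE i hi).2.2.2) hb hP hH
  simp only [hW] at key
  exact (key ψ false 0 hψ (by rw [hp0]; exact hu₃)).2 rfl
    (hl _ (fun n => (A.mem_nodes.1 (hM' n).1).1.2)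
      ((key φ true 0 hφ (by rw [hp0]; exact hu₂)).1 rfl))

theorem realizable_iff_exists_certificate
    (c : List (Symb (Signal P AP)) × List (Symb (Signal P AP))) :
    (∃ φ ψ : PromptLTL (Signal P AP), c = (φ.text, ψ.text) ∧ A.AsyncRealizable φ ψ) ↔
      ∃ z : Certificate P AP, A.Certifies z c := by
  constructor
  · rintro ⟨φ, ψ, rfl, h⟩
    obtain ⟨y, hy⟩ := (A.asyncRealizable_iff φ ψ).1 h
    exact A.exists_certificate hy
  · rintro ⟨z, hz⟩
    obtain ⟨φ, hφ⟩ := hz.1.1.exists_text hz.1.2.1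
    obtain ⟨ψ, hψ⟩ := hz.1.1.exists_text hz.1.2.2
    obtain rfl : c = (φ.text, ψ.text) := Prod.ext hφ hψ
    exact ⟨φ, ψ, rfl, (A.asyncRealizable_iff φ ψ).2 ⟨z.1, Certifies.realizes A hz⟩⟩

end Architecture

/-! ### Computability of the certificate check -/

namespace PrimrecPred

variable {α β : Type*} [Primcodable α] [Primcodable β]

theorem imp {p q : α → Prop} (hp : PrimrecPred p) (hq : PrimrecPred q) :
    PrimrecPred fun a => p a → q a :=
  (hp.not.or hq).of_eq fun _ => imp_iff_not_or.symm

theorem iff {p q : α → Prop} (hp : PrimrecPred p) (hq : PrimrecPred q) :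
    PrimrecPred fun a => p a ↔ q a :=
  ((hp.imp hq).and (hq.imp hp)).of_eq fun _ => iff_iff_implies_and_implies.symm

/-- All quantifiers in the certificate check run over computed lists, so `ball` and `bex` suffice to
keep it primitive recursive. -/
theorem ball {f : α → List β} {p : α → β → Prop} (hf : Primrec f)
    (hp : PrimrecPred fun x : α × β => p x.1 x.2) : PrimrecPred fun a => ∀ b ∈ f a, p a b :=
  (show PrimrecRel (fun L a => ∀ b ∈ L, p a b) from PrimrecRel.forall_mem_list (R := fun b a => p a b)
    (hp.comp (Primrec.pair Primrec.snd Primrec.fst))).comp hf Primrec.id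

theorem bex {f : α → List β} {p : α → β → Prop} (hf : Primrec f)
    (hp : PrimrecPred fun x : α × β => p x.1 x.2) : PrimrecPred fun a => ∃ b ∈ f a, p a b :=
  (show PrimrecRel (fun L a => ∃ b ∈ L, p a b) from PrimrecRel.exists_mem_list (R := fun b a => p a b)
    (hp.comp (Primrec.pair Primrec.snd Primrec.fst))).comp hf Primrec.id

theorem eq {f g : α → β} (hf : Primrec f) (hg : Primrec g) : PrimrecPred fun a => f a = g a :=
  Primrec.eq.comp hf hg

theorem mem {f : α → β} {g : α → List β} (hf : Primrec f) (hg : Primrec g) :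
    PrimrecPred fun a => f a ∈ g a :=
  (bex (p := fun a b => b = f a) hg (eq Primrec.snd (hf.comp Primrec.fst))).of_eq fun a => by simp

end PrimrecPred

namespace Primrec

variable {α β γ : Type*} [Primcodable α] [Primcodable β] [Primcodable γ]

theorem var : Primrec fun a : α => a := Primrec.id

theorem fst_of {f : α → β × γ} (hf : Primrec f) : Primrec fun a => (f a).1 := Primrec.fst.comp hf

theorem snd_of {f : α → β × γ} (hf : Primrec f) : Primrec fun a => (f a).2 := Primrec.snd.comp hf

theorem cons_of {f : α → β} {g : α → List β} (hf : Primrec f) (hg : Primrec g) :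
    Primrec fun a => f a :: g a := Primrec.list_cons.comp hf hg

theorem append_of {f g : α → List β} (hf : Primrec f) (hg : Primrec g) :
    Primrec fun a => f a ++ g a := Primrec.list_append.comp hf hg

theorem inr_of {f : α → γ} (hf : Primrec f) : Primrec fun a => (Sum.inr (f a) : β ⊕ γ) :=
  Primrec.sumInr.comp hf

end Primrec

theorem Primrec.sublists' {α : Type*} [Primcodable α] : Primrec (List.sublists' (α := α)) := by
  have h : Primrec fun l : List α =>
      l.foldr (fun a acc => acc ++ acc.map (List.cons a)) [[]] := by
    refine Primrec.list_foldr (h := fun _ (x : α × List (List α)) =>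
      x.2 ++ x.2.map (List.cons x.1)) Primrec.id
      (Primrec.const _) ?_
    refine Primrec.list_append.comp (Primrec.snd.comp Primrec.snd) (Primrec.list_map
      (Primrec.snd.comp Primrec.snd) ?_)
    exact Primrec.list_cons.comp (Primrec.fst.comp (Primrec.snd.comp Primrec.fst)) Primrec.snd
  refine h.of_eq fun l => ?_
  induction l with
  | nil => rfl
  | cons a l ih => rw [List.sublists'_cons, ← ih]; rfl

theorem Primrec.list_product {α β γ : Type*} [Primcodable α] [Primcodable β] [Primcodable γ]
    {f : α → List β} {g : α → List γ} (hf : Primrec f) (hg : Primrec g) :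
    Primrec fun a => f a ×ˢ g a := by
  refine Primrec.list_flatMap hf (Primrec.list_map (hg.comp Primrec.fst) ?_)
  exact Primrec.pair (Primrec.snd.comp Primrec.fst) Primrec.snd

namespace PromptLTL

variable {σ : Type*} [Primcodable σ]

theorem primrecPred_isLeft : PrimrecPred fun x : Symb σ => x.isLeft = true := by
  refine PrimrecPred.eq (Primrec.of_eq (Primrec.sumCasesOn (f := id)
    (g := fun _ _ => true) (h := fun _ _ => false) Primrec.id (Primrec.const _) (Primrec.const _))
    fun x => ?_) (Primrec.const _)
  cases x <;> rfl

theorem primrecPred_litHolds :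
    PrimrecPred fun x : (List σ × Bool) × Symb σ => LitHolds x.1.1 x.1.2 x.2 := by
  classical
  have h : PrimrecPred fun x : ((List σ × Bool) × Symb σ) × (Bool × σ) =>
      (x.2.2 ∈ x.1.1.1 ↔ x.2.1 = x.1.1.2) := by
    refine PrimrecPred.iff (PrimrecPred.mem ?_ ?_) (PrimrecPred.eq ?_ ?_)
    all_goals repeat with_reducible first
      | exact Primrec.var
      | refine Primrec.fst_of ?_ | refine Primrec.snd_of ?_
  have h' := Primrec.sumCasesOn (f := fun x : (List σ × Bool) × Symb σ => x.2)
    (g := fun x a => decide (a.2 ∈ x.1.1 ↔ a.1 = x.1.2)) (h := fun _ _ => true)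
    Primrec.snd h.decide (Primrec.const _)
  refine (PrimrecPred.eq h' (Primrec.const true)).of_eq fun x => ?_
  obtain ⟨_, _ | _⟩ := x <;> simp [LitHolds]

theorem primrecPred_subClosed : PrimrecPred fun Cl : List (Claim σ) => SubClosed Cl := by
  unfold SubClosed
  repeat' with_reducible first
    | exact Primrec.const _
    | exact Primrec.var
    | refine Primrec.fst_of ?_ | refine Primrec.snd_of ?_
    | refine PrimrecPred.and ?_ ?_ | refine PrimrecPred.or ?_ ?_
    | refine primrecPred_isLeft.comp ?_
    | refine PrimrecPred.ball ?_ ?_ | refine PrimrecPred.bex ?_ ?_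
    | refine PrimrecPred.eq ?_ ?_
    | refine Primrec.cons_of ?_ ?_ | refine Primrec.append_of ?_ ?_
    | refine Primrec.inr_of ?_

/-- The arguments of `Tableau`. -/
abbrev TableauArgs (σ : Type*) :=
  (List (Claim σ) × Bool × List σ) × (List (Claim σ) × List (Claim σ)) ×
    (List (Claim σ) × List (Claim σ))

theorem primrecPred_tableau : PrimrecPred fun x : TableauArgs σ =>
    Tableau x.1.1 x.1.2.1 x.1.2.2 x.2.1.1 x.2.1.2 x.2.2.1 x.2.2.2 := by
  unfold Tableau Claim.Is
  repeat' with_reducible first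
    | exact Primrec.const _
    | exact Primrec.var
    | refine Primrec.fst_of ?_ | refine Primrec.snd_of ?_
    | refine PrimrecPred.and ?_ ?_ | refine PrimrecPred.or ?_ ?_
    | refine primrecPred_litHolds.comp (Primrec.pair (Primrec.pair ?_ ?_) ?_)
    | refine PrimrecPred.ball ?_ ?_
    | refine PrimrecPred.imp ?_ ?_
    | refine PrimrecPred.mem ?_ ?_
    | refine PrimrecPred.eq ?_ ?_
    | refine Primrec.cons_of ?_ ?_ | refine Primrec.append_of ?_ ?_
    | refine Primrec.pair ?_ ?_

theorem primrecPred_promptHit :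
    PrimrecPred fun x : (List (Claim σ) × Claim σ) × List (Claim σ) =>
      PromptHit x.1.1 x.1.2 x.2 := by
  unfold PromptHit
  repeat' with_reducible first
    | exact Primrec.const _
    | exact Primrec.var
    | refine Primrec.fst_of ?_ | refine Primrec.snd_of ?_
    | refine PrimrecPred.or ?_ ?_
    | refine PrimrecPred.ball ?_ ?_
    | refine PrimrecPred.not ?_
    | refine PrimrecPred.imp ?_ ?_
    | refine PrimrecPred.mem ?_ ?_
    | refine PrimrecPred.eq ?_ ?_
    | refine Primrec.cons_of ?_ ?_
    | refine Primrec.pair ?_ ?_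

theorem primrecPred_hit :
    PrimrecPred fun x : (List (Claim σ) × Claim σ) × List (Claim σ) =>
      Hit x.1.1 x.1.2 x.2 := by
  unfold Hit Claim.Is
  refine PrimrecPred.and primrecPred_promptHit ?_
  repeat' with_reducible first
    | exact Primrec.const _
    | exact Primrec.var
    | refine Primrec.fst_of ?_ | refine Primrec.snd_of ?_
    | refine PrimrecPred.or ?_ ?_
    | refine PrimrecPred.ball ?_ ?_
    | refine PrimrecPred.not ?_
    | refine PrimrecPred.imp ?_ ?_
    | refine PrimrecPred.mem ?_ ?_
    | refine PrimrecPred.eq ?_ ?_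
    | refine Primrec.cons_of ?_ ?_ | refine Primrec.append_of ?_ ?_
    | refine Primrec.pair ?_ ?_

end PromptLTL

/-- Unbounded search through the codes of all `b`; a number that decodes to nothing counts as a
failure. -/
theorem PrimrecPred.rePred_exists {α β : Type*} [Primcodable α] [Primcodable β]
    {p : β → α → Prop} (hp : PrimrecPred fun x : β × α => p x.1 x.2) :
    REPred fun a => ∃ b, p b a := by
  classical
  let q : α → ℕ → Bool := fun a n =>
    ((Encodable.decode n : Option β).map fun b => decide (p b a)).getD false
  have hq : Primrec₂ q := by
    refine Primrec.option_getD.comp (Primrec.option_map (g := fun x b => decide (p b x.1))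
      (Primrec.decode.comp Primrec.snd) ?_) (Primrec.const _)
    exact (hp.comp (Primrec.pair Primrec.snd (Primrec.fst.comp Primrec.fst))).decide
  have hr := Partrec.rfind (p := fun a n => Part.some (q a n)) hq.to_comp.partrec₂
  refine hr.dom_re.of_eq fun a => Nat.rfind_dom.trans ⟨?_, ?_⟩
  · rintro ⟨n, hn, -⟩
    rw [Part.mem_some_iff] at hn
    rcases h : (Encodable.decode n : Option β) with _ | b
    · simp [q, h] at hn
    · exact ⟨b, by simpa [q, h] using hn⟩
  · rintro ⟨b, hb⟩
    exact ⟨Encodable.encode b, Part.mem_some_iff.2 (by simp [q, hb]), fun _ => trivial⟩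

theorem PrimrecPred.comp₃ {α β γ δ : Type*} [Primcodable α] [Primcodable β] [Primcodable γ]
    [Primcodable δ] {p : β → γ → δ → Prop} {f : α → β} {g : α → γ} {h : α → δ}
    (hp : PrimrecPred fun x : β × γ × δ => p x.1 x.2.1 x.2.2) (hf : Primrec f) (hg : Primrec g)
    (hh : Primrec h) : PrimrecPred fun a => p (f a) (g a) (h a) :=
  hp.comp (hf.pair (hg.pair hh))

namespace CycleCover

variable {α V κ : Type*} [Primcodable α] [Primcodable V] [Primcodable κ] {U : α → List V}
  {R : α → List (V × V)}

theorem primrecPred_closedRel {Q : α → V → V → Prop} (hU : Primrec U) (hR : Primrec R)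
    (hQ : PrimrecPred fun x : α × V × V => Q x.1 x.2.1 x.2.2) :
    PrimrecPred fun a => ClosedRel (U a) (R a) (Q a) := by
  unfold ClosedRel
  repeat' with_reducible first
    | exact Primrec.var
    | refine Primrec.fst_of ?_ | refine Primrec.snd_of ?_
    | refine hU.comp ?_ | refine hR.comp ?_
    | refine PrimrecPred.and ?_ ?_
    | refine PrimrecPred.ball ?_ ?_
    | refine PrimrecPred.imp ?_ ?_
    | refine PrimrecPred.mem ?_ ?_
    | refine hQ.comp₃ ?_ ?_ ?_
    | refine Primrec.pair ?_ ?_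

theorem primrecPred_listCovers {H : α → κ → V → Prop} {Cl : α → List κ} {x : α → V}
    (hU : Primrec U) (hR : Primrec R)
    (hH : PrimrecPred fun x : α × κ × V => H x.1 x.2.1 x.2.2) (hCl : Primrec Cl)
    (hx : Primrec x) : PrimrecPred fun a => ListCovers (U a) (R a) (H a) (Cl a) (x a) := by
  unfold ListCovers
  repeat' with_reducible first
    | exact Primrec.var
    | refine Primrec.fst_of ?_ | refine Primrec.snd_of ?_
    | refine hU.comp ?_ | refine hR.comp ?_ | refine hCl.comp ?_ | refine hx.comp ?_
    | refine PrimrecPred.and ?_ ?_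
    | refine PrimrecPred.ball ?_ ?_ | refine PrimrecPred.bex ?_ ?_
    | refine PrimrecPred.mem ?_ ?_
    | refine hH.comp₃ ?_ ?_ ?_
    | refine Primrec.pair ?_ ?_

end CycleCover

namespace Architecture

open PromptLTL CycleCover

variable {α P AP : Type*} [Primcodable α] [Finite P] [Primcodable P] [Primcodable AP]
  (A : Architecture P AP)

theorem primrec_restrict {σ : Type*} [Primcodable σ] {f g : α → List σ} (hf : Primrec f)
    (hg : Primrec g) : Primrec fun a => restrict (f a) {b | b ∈ g a} := by
  classical
  have h : PrimrecRel fun (b : σ) (l : List σ) => b ∈ l :=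
    PrimrecPred.mem Primrec.fst Primrec.snd
  refine (h.listFilter.comp hf hg).of_eq fun a => ?_
  exact List.filter_congr fun b _ => decide_eq_decide.2 Iff.rfl

theorem primrec_initState :
    Primrec fun x : Tables P AP × P => initState x.1 x.2 :=
  (Primrec.list_getD 0).comp (Primrec.fst.comp Primrec.fst) (Primrec.encode.comp Primrec.snd)

theorem primrec_stepState : Primrec fun x : Tables P AP × P × ℕ × List (Signal P AP) =>
    stepState x.1 x.2.1 x.2.2.1 x.2.2.2 := by
  classical
  unfold stepState
  have h : PrimrecPred fun x : Tables P AP × P × ℕ × List (Signal P AP) =>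
      (Signal.sched x.2.1 : Signal P AP) ∈ x.2.2.2 :=
    PrimrecPred.mem (Primrec.sumInr.comp (Primrec.fst.comp Primrec.snd))
      (Primrec.snd.comp (Primrec.snd.comp Primrec.snd))
  refine (Primrec.ite h ((Primrec.list_getD 0).comp
    (Primrec.fst.comp (Primrec.snd.comp Primrec.fst)) (Primrec.encode.comp Primrec.snd))
    (Primrec.fst.comp (Primrec.snd.comp Primrec.snd))).of_eq fun x => ?_
  congr

/-- `A.outputList` involves choices, but every function on the finite type `P` is primitive
recursive, and `A` is a fixed parameter. -/
theorem primrec_labelState : Primrec fun x : Tables P AP × P × ℕ =>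
    A.labelState x.1 x.2.1 x.2.2 :=
  primrec_restrict ((Primrec.dom_finite A.outputList).comp (Primrec.fst.comp Primrec.snd))
    ((Primrec.list_getD []).comp (Primrec.snd.comp (Primrec.snd.comp Primrec.fst))
      (Primrec.encode.comp Primrec.snd))

theorem primrec_localState : Primrec fun x : List ℕ × P => x.1.getD (procIdx x.2) 0 :=
  (Primrec.list_getD 0).comp Primrec.fst ((Primrec.dom_finite procIdx).comp Primrec.snd)

theorem primrec_letter : Primrec fun x : Tables P AP × List ℕ × List (Signal P AP) =>
    A.letter x.1 x.2.1 x.2.2 := by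
  refine Primrec.list_append.comp (Primrec.snd.comp Primrec.snd)
    (Primrec.list_flatMap (Primrec.const _) ?_)
  refine A.primrec_labelState.comp (Primrec.pair (Primrec.fst.comp Primrec.fst)
    (Primrec.pair Primrec.snd ?_))
  exact primrec_localState.comp (Primrec.pair (Primrec.fst.comp (Primrec.snd.comp Primrec.fst))
    Primrec.snd)

theorem primrec_initGlobal : Primrec (initGlobal : Tables P AP → List ℕ) :=
  Primrec.list_map (Primrec.const _) primrec_initState

theorem primrec_stepGlobal : Primrec fun x : Tables P AP × List ℕ × List (Signal P AP) =>
    A.stepGlobal x.1 x.2.1 x.2.2 := by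
  refine Primrec.list_map (Primrec.const _) ?_
  refine primrec_stepState.comp (Primrec.pair (Primrec.fst.comp Primrec.fst)
    (Primrec.pair Primrec.snd (Primrec.pair ?_ ?_)))
  · exact primrec_localState.comp (Primrec.pair (Primrec.fst.comp (Primrec.snd.comp Primrec.fst))
      Primrec.snd)
  · exact primrec_restrict ((Primrec.dom_finite A.inputList).comp Primrec.snd)
      (A.primrec_letter.comp Primrec.fst)

/-- The arguments of `Edge`. -/
abbrev EdgeArgs (P AP : Type*) :=
  (Tables P AP × List (Claim (Signal P AP)) × Bool) × Node (Signal P AP) × Node (Signal P AP)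

theorem primrecPred_edge : PrimrecPred fun x : EdgeArgs P AP =>
    A.Edge x.1.1 x.1.2.1 x.1.2.2 x.2.1 x.2.2 := by
  unfold Edge
  refine PrimrecPred.and (PrimrecPred.eq ?_ ?_)
    (PrimrecPred.comp (f := fun x : EdgeArgs P AP => ((x.1.2.1, x.1.2.2,
      A.letter x.1.1 x.2.1.1.1 x.2.1.1.2), x.2.1.2, x.2.2.2)) primrecPred_tableau ?_)
  all_goals repeat' with_reducible first
    | exact Primrec.var
    | refine Primrec.fst_of ?_ | refine Primrec.snd_of ?_
    | refine A.primrec_stepGlobal.comp (Primrec.pair ?_ (Primrec.pair ?_ ?_))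
    | refine A.primrec_letter.comp (Primrec.pair ?_ (Primrec.pair ?_ ?_))
    | refine Primrec.pair ?_ ?_

theorem primrec_nodes : Primrec fun x : List (List ℕ) × List (Claim (Signal P AP)) =>
    A.nodes x.1 x.2 :=
  Primrec.list_product (Primrec.list_product Primrec.fst (Primrec.const _))
    (Primrec.list_product (Primrec.sublists'.comp Primrec.snd) (Primrec.sublists'.comp Primrec.snd))

/-- The arguments of `CheckedEdge`. -/
abbrev CheckedEdgeArgs (P AP : Type*) :=
  (Tables P AP × List (Claim (Signal P AP)) × List (Node (Signal P AP)) ×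
    List (Node (Signal P AP) × Node (Signal P AP))) × Node (Signal P AP) × Node (Signal P AP)

set_option synthInstance.maxHeartbeats 200000 in
set_option synthInstance.maxSize 1000 in
theorem primrecPred_checkedEdge : PrimrecPred fun x : CheckedEdgeArgs P AP =>
    A.CheckedEdge x.1.1 x.1.2.1 x.1.2.2.1 x.1.2.2.2 x.2.1 x.2.2 := by
  unfold CheckedEdge
  refine PrimrecPred.or ?_ (PrimrecPred.and ?_ (primrecPred_listCovers
    (H := fun (a : CheckedEdgeArgs P AP) c (u : Node (Signal P AP)) => PromptHit a.1.2.1 c u.2.1) ?_ ?_ ?_ ?_ ?_))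
  all_goals repeat' with_reducible first
    | exact Primrec.const _
    | exact Primrec.var
    | refine Primrec.fst_of ?_ | refine Primrec.snd_of ?_
    | refine primrecPred_promptHit.comp (Primrec.pair (Primrec.pair ?_ ?_) ?_)
    | refine A.primrecPred_edge.comp (Primrec.pair (Primrec.pair ?_ (Primrec.pair ?_ ?_))
        (Primrec.pair ?_ ?_))

/-- The arguments of `NoCycle`. -/
abbrev NoCycleArgs (P AP : Type*) :=
  (Tables P AP × List (Claim (Signal P AP)) × List (Node (Signal P AP)) ×
    List (Node (Signal P AP) × Node (Signal P AP))) ×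
    List (Symb (Signal P AP)) × List (Symb (Signal P AP))

set_option synthInstance.maxHeartbeats 200000 in
set_option synthInstance.maxSize 1000 in
theorem primrecPred_noCycle : PrimrecPred fun x : NoCycleArgs P AP =>
    NoCycle x.1.1 x.1.2.1 x.1.2.2.1 x.1.2.2.2 x.2 := by
  unfold NoCycle
  refine PrimrecPred.ball ?_ (PrimrecPred.imp ?_ (PrimrecPred.ball ?_ (PrimrecPred.imp ?_
    (PrimrecPred.not (primrecPred_listCovers
    (H := fun (a : (NoCycleArgs P AP × Node (Signal P AP)) × Node (Signal P AP)) c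
      (u : Node (Signal P AP)) =>
      Hit a.1.1.1.2.1 c u.2.1) ?_ ?_ ?_ ?_ ?_)))))
  all_goals repeat' with_reducible first
    | exact Primrec.const _
    | exact Primrec.var
    | refine Primrec.fst_of ?_ | refine Primrec.snd_of ?_
    | refine PrimrecPred.and ?_ ?_
    | refine PrimrecPred.mem ?_ ?_
    | refine PrimrecPred.eq ?_ ?_
    | refine primrecPred_hit.comp (Primrec.pair (Primrec.pair ?_ ?_) ?_)
    | refine primrec_initGlobal.comp ?_
    | refine Primrec.pair ?_ ?_

set_option synthInstance.maxHeartbeats 200000 in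
set_option synthInstance.maxSize 1000 in
theorem primrecPred_certifies : PrimrecPred fun x : Certificate P AP ×
    (List (Symb (Signal P AP)) × List (Symb (Signal P AP))) => A.Certifies x.1 x.2 := by
  unfold Certifies
  repeat' with_reducible first
    | exact Primrec.const _
    | exact Primrec.var
    | refine Primrec.fst_of ?_ | refine Primrec.snd_of ?_
    | refine PrimrecPred.and ?_ ?_
    | refine primrecPred_subClosed.comp ?_
    | refine primrecPred_closedRel ?_ ?_ ?_
    | refine A.primrecPred_edge.comp (Primrec.pair (Primrec.pair ?_ (Primrec.pair ?_ ?_))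
        (Primrec.pair ?_ ?_))
    | refine A.primrecPred_checkedEdge.comp (Primrec.pair
        (Primrec.pair ?_ (Primrec.pair ?_ (Primrec.pair ?_ ?_))) (Primrec.pair ?_ ?_))
    | refine primrecPred_noCycle.comp (Primrec.pair
        (Primrec.pair ?_ (Primrec.pair ?_ (Primrec.pair ?_ ?_))) ?_)
    | refine A.primrec_nodes.comp (Primrec.pair ?_ ?_)
    | refine A.primrec_stepGlobal.comp (Primrec.pair ?_ (Primrec.pair ?_ ?_))
    | refine primrec_initGlobal.comp ?_
    | refine PrimrecPred.ball ?_ ?_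
    | refine PrimrecPred.mem ?_ ?_
    | refine Primrec.pair ?_ ?_

set_option synthInstance.maxHeartbeats 200000 in
set_option synthInstance.maxSize 1000 in
theorem rePred_realizable :
    REPred fun c : List (Symb (Signal P AP)) × List (Symb (Signal P AP)) =>
      ∃ φ ψ : PromptLTL (Signal P AP), c = (φ.text, ψ.text) ∧ A.AsyncRealizable φ ψ :=
  A.primrecPred_certifies.rePred_exists.of_eq fun c =>
    (A.realizable_iff_exists_certificate c).symm

end Architecture

theorem mainTheorem1 {P AP : Type*} [Finite P] [Primcodable P] [Primcodable AP]
    (A : Architecture P AP) :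
    REPred fun c : List (PromptLTL.Symb (Signal P AP)) × List (PromptLTL.Symb (Signal P AP)) =>
      ∃ φ ψ : PromptLTL (Signal P AP), c = (φ.text, ψ.text) ∧ A.AsyncRealizable φ ψ :=
  A.rePred_realizable
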